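/- Let $p$ be a prime, let $\mathbf{C}_p$ be the completion of an algebraic closure of $\mathbf{Q}_p$, and let $\mathscr{O}_{\mathbf{C}_p}^\flat=\varprojlim_{x\mapsto x^p}\mathscr{O}_{\mathbf{C}_p}/p$ and $\mathbf{A}_{\mathrm{inf}}=W(\mathscr{O}_{\mathbf{C}_p}^\flat)$, with its Frobenius $\varphi$. Fix a compatible system $(p^q)_{q\in\mathbf{Q}_{\geq 0}}$ of rational powers of $p$ in $\mathscr{O}_{\mathbf{C}_p}$ (so $p^0=1$, $p^1=p$ and $p^{q+r}=p^qp^r$), and for $q\in\mathbf{Q}_{\ge 0}$ let $\varpi^q\in\mathscr{O}_{\mathbf{C}_p}^\flat$ be the class of $(p^q,p^{q/p},p^{q/p^2},\ldots)$, with Teichmüller lift $[\varpi]^q:=[\varpi^q]\in\mathbf{A}_{\mathrm{inf}}$. Let $\lambda=\frac{m'}{m}$ be a positive rational number in lowest terms, and put $D_\lambda^\circ=\mathbf{Z}_p[\![u]\!]\left\langle\frac{p^m}{u^{m'}}\right\rangle$ and $D_\lambda=D_\lambda^\circ\left[\frac1u\right]$. Here, for a ring $A$ with the topology defined by an ideal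 $I$ and for $f,s\in A$, $A\left\langle\frac fs\right\rangle$ denotes the $I$-adic completion of $A[X]/(sX-f)$; we take $I=(p,u)$ for $A=\mathbf{Z}_p[\![u]\!]$. Let $R$ be a pseudoaffinoid $D_\lambda$-algebra, with pseudo-uniformizer $u$, and let $R_0\subset R$ be a ring of definition that is strictly topologically of finite type over $D_\lambda^\circ$: that is, $R$ is a complete separated topological $D_\lambda$-algebra in which $u$ is topologically nilpotent, and $R_0\subset R$ is an open $D_\lambda^\circ$-subalgebra whose topology is adic for a finitely generated ideal and which is a topological quotient of $D_\lambda^\circ\langle X_1,\ldots,X_n\rangle$ for some $n$. For $b\in\mathbf{Q}_{>0}\cup\{\infty\}$ put $$\widetilde\Lambda_{R_0,[0,b],0}:=(R_0\,\widehat\otimes_{\mathbf{Z}_p}\mathbf{A}_{\mathrm{inf}})\left\langle\frac{u}{[\varpi]^{1/b}}\right\rangle ,$$ where $R_0$ has the $u$-adic topology, $\mathbf{A}_{\mathrm{inf}}$ has the $(p,[\varpi])$-adic topology, and $1/\infty:=0$, $\infty/p:=\infty$. Then for every $b\in\mathbf{Q}_{>0}\cup\{\infty\}$ there is an exact sequence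 of $R_0$-modules $$0\rightarrow R_0\rightarrow\widetilde\Lambda_{R_0,[0,b],0}\xrightarrow{\ \varphi-1\ }\widetilde\Lambda_{R_0,[0,b/p],0}\rightarrow 0 .$$ Here the first map is the structure map; $\varphi$ is the $R_0$-algebra map induced by the Frobenius of $\mathbf{A}_{\mathrm{inf}}$, with $\varphi\left(\frac{u}{[\varpi]^{1/b}}\right)=\frac{u}{[\varpi]^{p/b}}$; and $1$ denotes the natural map $\widetilde\Lambda_{R_0,[0,b],0}\to\widetilde\Lambda_{R_0,[0,b/p],0}$ that is the identity on $R_0\,\widehat\otimes\,\mathbf{A}_{\mathrm{inf}}$, with $\frac{u}{[\varpi]^{1/b}}\mapsto[\varpi]^{(p-1)/b}\cdot\frac{u}{[\varpi]^{p/b}}$. -/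

import Mathlib

open scoped TensorProduct

noncomputable section

namespace PseudoRigid

/-! ## Adic completions and rational localizations -/

section Completion

variable {S A B : Type*} [CommRing S] [CommRing A] [CommRing B] [Algebra S A] [Algebra S B]

/-- The map `A / I ^ n → B / J ^ n` induced by an algebra homomorphism `g : A → B` with
`g(I) ⊆ J`. -/
def quotPowMap (I : Ideal A) (J : Ideal B) (g : A →ₐ[S] B) (h : I.map g ≤ J) (n : ℕ) :
    A ⧸ I ^ n →ₐ[S] B ⧸ J ^ n :=
  Ideal.quotientMapₐ (J ^ n) g (by
    rw [← Ideal.map_le_iff_le_comap, Ideal.map_pow]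
    exact Ideal.pow_right_mono h n)

theorem quotPowMap_mk (I : Ideal A) (J : Ideal B) (g : A →ₐ[S] B) (h : I.map g ≤ J) (n : ℕ)
    (a : A) : quotPowMap I J g h n (Ideal.Quotient.mk _ a) = Ideal.Quotient.mk _ (g a) := rfl

theorem quotPowMap_compat (I : Ideal A) (J : Ideal B) (g : A →ₐ[S] B) (h : I.map g ≤ J)
    {m n : ℕ} (hle : m ≤ n) :
    (Ideal.Quotient.factorₐ S (Ideal.pow_le_pow_right hle)).comp
      ((quotPowMap I J g h n).comp ((AdicCompletion.evalₐ I n).restrictScalars S)) =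
    (quotPowMap I J g h m).comp ((AdicCompletion.evalₐ I m).restrictScalars S) := by
  ext x
  induction x using AdicCompletion.induction_on with
  | _ a =>
    have h2 := congrArg (quotPowMap I J g h m) (AdicCompletion.Ideal.mk_eq_mk I hle a)
    simpa [quotPowMap_mk] using h2

/-- The map induced on adic completions by an algebra homomorphism `g : A → B` with
`g(I) ⊆ J`: on `A / I ^ n` it is the map `A / I ^ n → B / J ^ n` induced by `g`. -/
def adicMap (I : Ideal A) (J : Ideal B) (g : A →ₐ[S] B) (h : I.map g ≤ J) :
    AdicCompletion I A →ₐ[S] AdicCompletion J B :=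
  AdicCompletion.liftAlgHom J
    (fun n ↦ (quotPowMap I J g h n).comp ((AdicCompletion.evalₐ I n).restrictScalars S))
    (quotPowMap_compat I J g h)

/-- On elements of `A`, the map on completions is `g`. -/
theorem adicMap_of (I : Ideal A) (J : Ideal B) (g : A →ₐ[S] B) (h : I.map g ≤ J) (x : A) :
    adicMap I J g h (algebraMap A (AdicCompletion I A) x) =
      algebraMap B (AdicCompletion J B) (g x) := by
  refine AdicCompletion.ext_evalₐ fun n ↦ ?_
  refine (AdicCompletion.evalₐ_liftAlgHom J _ (quotPowMap_compat I J g h) n _).trans ?_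
  simp [quotPowMap_mk]

variable (I : Ideal A) (f s : A)

/-- The presentation `A[X] / (s X - f)` of the `A`-algebra generated by the fraction `f / s`. -/
abbrev FracAlg : Type _ :=
  Polynomial A ⧸ Ideal.span {Polynomial.C s * Polynomial.X - Polynomial.C f}

/-- The ideal of `A[X] / (s X - f)` generated by `I`. -/
abbrev fracIdeal : Ideal (FracAlg f s) := I.map (algebraMap A (FracAlg f s))

/-- The ring `A⟨f / s⟩`: the completion of `A[X] / (s X - f)` for the topology defined by `I`.
(Equivalently: the quotient of the ring `A⟨X⟩` of restricted power series by the closure of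
the ideal generated by `s X - f`.) -/
def RatLoc : Type _ := AdicCompletion (fracIdeal I f s) (FracAlg f s)

instance : CommRing (RatLoc I f s) :=
  inferInstanceAs (CommRing (AdicCompletion (fracIdeal I f s) (FracAlg f s)))

instance : Algebra S (RatLoc I f s) :=
  inferInstanceAs (Algebra S (AdicCompletion (fracIdeal I f s) (FracAlg f s)))


variable {I f s} {J : Ideal B} {f' s' : B}

/-- The `S`-algebra map `A[X] / (s X - f) → B[X] / (s' X - f')` given by `g` on `A` and by
`X ↦ t X`, when `g f = f'` and `(g s) t = s'`. It sends `f / s` to `t (f' / s')`. -/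
def fracMap (g : A →ₐ[S] B) (t : B) (hf : g f = f') (hs : g s * t = s') :
    FracAlg f s →ₐ[S] FracAlg f' s' :=
  Ideal.Quotient.liftₐ _
    ((Ideal.Quotient.mkₐ S _).comp
      (((Polynomial.aeval (Polynomial.C t * Polynomial.X : Polynomial B)).restrictScalars S).comp
        (Polynomial.mapAlgHom g)))
    (by
      intro a ha
      induction ha using Submodule.span_induction with
      | mem x hx =>
        rw [Set.mem_singleton_iff] at hx
        subst hx hf hs
        rw [AlgHom.comp_apply, Ideal.Quotient.mkₐ_eq_mk, Ideal.Quotient.eq_zero_iff_mem]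
        refine Ideal.subset_span ?_
        simp [mul_assoc]
      | zero => simp
      | add x y _ _ hx hy => rw [map_add, hx, hy, add_zero]
      | smul r x _ hx => rw [smul_eq_mul, map_mul, hx, mul_zero])

theorem fracMap_algebraMap (g : A →ₐ[S] B) (t : B) (hf : g f = f') (hs : g s * t = s') (a : A) :
    fracMap g t hf hs (algebraMap A (FracAlg f s) a) = algebraMap B (FracAlg f' s') (g a) := by
  change fracMap g t hf hs (Ideal.Quotient.mk _ (Polynomial.C a)) =
    Ideal.Quotient.mk _ (Polynomial.C (g a))
  exact (Ideal.Quotient.lift_mk _ _ _).trans (by simp)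

/-- The map `A⟨f / s⟩ → B⟨f' / s'⟩` given by `g` on `A` and sending `f / s` to
`t (f' / s')`, when `g(I) ⊆ J`, `g f = f'` and `(g s) t = s'`. -/
def ratMap (g : A →ₐ[S] B) (hg : I.map g ≤ J) (t : B) (hf : g f = f') (hs : g s * t = s') :
    RatLoc I f s →ₐ[S] RatLoc J f' s' :=
  adicMap (fracIdeal I f s) (fracIdeal J f' s') (fracMap g t hf hs) (by
    rw [fracIdeal, Ideal.map_le_iff_le_comap, Ideal.map_le_iff_le_comap]
    intro a ha
    rw [Ideal.mem_comap, Ideal.mem_comap, fracMap_algebraMap]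
    exact Ideal.mem_map_of_mem _ (hg (Ideal.mem_map_of_mem _ ha)))

end Completion

/-! ## The rings `D_λ` and `D_λ°` -/

section Dlam

variable (p : ℕ) [Fact p.Prime] (lam : ℚ)

/-- `D_λ° = ℤ_p[[u]]⟨p ^ m / u ^ m'⟩` for `λ = m' / m` in lowest terms, where `ℤ_p[[u]]` carries
its `(p, u)`-adic topology. -/
abbrev DlamInt : Type :=
  RatLoc (A := PowerSeries ℤ_[p]) (Ideal.span {(p : PowerSeries ℤ_[p]), PowerSeries.X})
    ((p : PowerSeries ℤ_[p]) ^ lam.den) (PowerSeries.X ^ lam.num.natAbs)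

/-- The element `u` of `D_λ°`. -/
def uD : DlamInt p lam :=
  algebraMap (PowerSeries ℤ_[p]) (DlamInt p lam) PowerSeries.X

/-- `D_λ = D_λ°[1 / u]`. -/
abbrev Dlam : Type := Localization.Away (uD p lam)

/-- The ring `D_λ°⟨X_1, …, X_n⟩` of restricted power series: the `u`-adic completion of
`D_λ°[X_1, …, X_n]`. -/
abbrev DlamIntTate (n : ℕ) : Type :=
  AdicCompletion (Ideal.span {algebraMap (DlamInt p lam) (MvPolynomial (Fin n) (DlamInt p lam))
    (uD p lam)}) (MvPolynomial (Fin n) (DlamInt p lam))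

variable {p lam}

/-- The conditions on a subring `R₀` of a complete separated topological `D_λ`-algebra `R`: `R₀`
is a ring of definition strictly topologically of finite type over `D_λ°`, and `u` is a
pseudo-uniformizer of `R` (it is invertible in every `D_λ`-algebra). Then `R` is Tate, and `R₀`
is formally of finite type over `ℤ_p` because `D_λ°` is; thus `R` is pseudoaffinoid. -/
structure IsPseudoaffinoidOver {R : Type*} [CommRing R] [UniformSpace R]
    [IsUniformAddGroup R] [IsTopologicalRing R] [CompleteSpace R] [T2Space R]
    [Algebra (DlamInt p lam) R] (R₀ : Subalgebra (DlamInt p lam) R) : Prop where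
  /-- `R₀` is open in `R` -/
  isOpen : IsOpen (R₀ : Set R)
  /-- the topology induced on `R₀` is adic for a finitely generated ideal -/
  adic : ∃ I : Ideal R₀, I.FG ∧ IsAdic I
  /-- `u` is topologically nilpotent -/
  nilpotent : IsTopologicallyNilpotent (algebraMap (DlamInt p lam) R (uD p lam))
  /-- `R₀` is a topological quotient of some `D_λ°⟨X_1, …, X_n⟩` -/
  finiteType : ∃ (n : ℕ) (g : DlamIntTate p lam n →ₐ[DlamInt p lam] R₀),
    @IsOpenQuotientMap _ _ (Ideal.span {algebraMap (DlamInt p lam) (DlamIntTate p lam n)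
      (uD p lam)}).adicTopology _ g

end Dlam

/-! ## The ring `A_inf` -/

section Ainf

variable (p : ℕ) [Fact p.Prime]

instance fact_not_isUnit : Fact (¬ IsUnit (p : 𝓞_ℂ_[p])) := ⟨by
  intro h
  have h1 := (PadicComplexInt.integers p).isUnit_iff_valuation_eq_one.1 h
  rw [map_natCast, PadicComplex.valuation_p, one_div, inv_eq_one] at h1
  exact (Fact.out : p.Prime).ne_one (by exact_mod_cast h1)⟩

/-- `O_{ℂ_p}^♭`, the inverse limit of `O_{ℂ_p} / p` along `x ↦ x ^ p`. -/
abbrev OFlat : Type := PreTilt 𝓞_ℂ_[p] p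

/-- `A_inf = W(O_{ℂ_p}^♭)`. -/
abbrev Ainf : Type := WittVector p (OFlat p)

/-- The structure map `ℤ_p = W(𝔽_p) → W(O_{ℂ_p}^♭)`. -/
def zpToAinf : ℤ_[p] →+* Ainf p :=
  (WittVector.map (ZMod.castHom dvd_rfl (OFlat p))).comp (WittVector.equiv p).symm.toRingHom

instance : Algebra ℤ_[p] (Ainf p) := (zpToAinf p).toAlgebra

/-- The Frobenius `φ` of `A_inf`, as a `ℤ_p`-algebra homomorphism. -/
def frobAinf : Ainf p →ₐ[ℤ_[p]] Ainf p where
  __ := (WittVector.frobenius : Ainf p →+* Ainf p)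
  commutes' x := by
    change WittVector.frobenius (WittVector.map _ ((WittVector.equiv p).symm x)) =
      WittVector.map _ ((WittVector.equiv p).symm x)
    rw [WittVector.frobenius_eq_map_frobenius]
    ext n
    rw [WittVector.map_coeff, WittVector.map_coeff]
    exact RingHom.congr_fun (RingHom.ext_zmod
      ((frobenius (OFlat p) p).comp (ZMod.castHom dvd_rfl (OFlat p)))
      (ZMod.castHom dvd_rfl (OFlat p))) _

/-- A compatible system of rational powers `p ^ q` (`q ≥ 0`) of `p` in `O_{ℂ_p}`. -/
structure PowSystem where
  /-- the chosen power `p ^ q` -/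
  pow : ℚ≥0 → 𝓞_ℂ_[p]
  pow_zero : pow 0 = 1
  pow_one : pow 1 = p
  pow_add : ∀ q r, pow (q + r) = pow q * pow r

variable {p}

theorem PowSystem.pow_nat_mul (w : PowSystem p) (n : ℕ) (q : ℚ≥0) :
    w.pow (n * q) = w.pow q ^ n := by
  induction n with
  | zero => simp [w.pow_zero]
  | succ n ih => rw [Nat.cast_succ, add_mul, one_mul, w.pow_add, ih, pow_succ]

/-- `ϖ ^ q ∈ O_{ℂ_p}^♭`, the class of `(p ^ q, p ^ (q / p), p ^ (q / p ^ 2), …)`. In particular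
`ϖ = ϖ ^ 1` is a compatible system of `p`-power roots of `p`. -/
def PowSystem.varpi (w : PowSystem p) (q : ℚ≥0) : OFlat p :=
  (⟨fun n ↦ Ideal.Quotient.mk _ (w.pow (q / p ^ n)), fun n ↦ by
    have hp : (p : ℚ≥0) ≠ 0 := by exact_mod_cast (Fact.out : p.Prime).ne_zero
    rw [← map_pow, ← w.pow_nat_mul]
    congr 2
    rw [pow_succ]
    field_simp⟩ : Perfection (ModP 𝓞_ℂ_[p] p) p)

theorem PowSystem.varpi_add (w : PowSystem p) (q r : ℚ≥0) :
    w.varpi (q + r) = w.varpi q * w.varpi r := by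
  refine Subtype.ext (funext fun n ↦ ?_)
  change Ideal.Quotient.mk _ (w.pow ((q + r) / p ^ n)) =
    Ideal.Quotient.mk _ (w.pow (q / p ^ n)) * Ideal.Quotient.mk _ (w.pow (r / p ^ n))
  rw [add_div, w.pow_add, map_mul]

theorem PowSystem.varpi_zero (w : PowSystem p) : w.varpi 0 = 1 := by
  refine Subtype.ext (funext fun n ↦ ?_)
  change Ideal.Quotient.mk _ (w.pow (0 / p ^ n)) = 1
  rw [zero_div, w.pow_zero, map_one]

theorem PowSystem.varpi_nat_mul (w : PowSystem p) (n : ℕ) (q : ℚ≥0) :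
    w.varpi (n * q) = w.varpi q ^ n := by
  induction n with
  | zero => simp [w.varpi_zero]
  | succ n ih => rw [Nat.cast_succ, add_mul, one_mul, w.varpi_add, ih, pow_succ]

/-- The Teichmüller lift `[ϖ ^ q] ∈ A_inf`. -/
def PowSystem.teich (w : PowSystem p) (q : ℚ≥0) : Ainf p :=
  WittVector.teichmuller p (w.varpi q)

theorem PowSystem.teich_add (w : PowSystem p) (q r : ℚ≥0) :
    w.teich (q + r) = w.teich q * w.teich r := by
  rw [teich, w.varpi_add, map_mul, teich, teich]

theorem PowSystem.teich_nat_mul (w : PowSystem p) (n : ℕ) (q : ℚ≥0) :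
    w.teich (n * q) = w.teich q ^ n := by
  rw [teich, w.varpi_nat_mul, map_pow, teich]

theorem PowSystem.frob_teich (w : PowSystem p) (q : ℚ≥0) :
    frobAinf p (w.teich q) = w.teich (p * q) := by
  change WittVector.frobenius (w.teich q) = _
  rw [WittVector.frobenius_eq_map_frobenius, teich, WittVector.map_teichmuller, teich,
    w.varpi_nat_mul, frobenius_def]

end Ainf

/-! ## The rings `Λ̃_{R₀,[0,b],0}` -/

/-- The exponent `1 / b`, with `1 / ∞ = 0`. -/
def invExp : WithTop ℚ≥0 → ℚ≥0
  | ⊤ => 0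
  | (b : ℚ≥0) => b⁻¹

/-- `b / p`, with `∞ / p = ∞`. -/
def divP (p : ℕ) (b : WithTop ℚ≥0) : WithTop ℚ≥0 := b.map (· / (p : ℚ≥0))

theorem invExp_divP (p : ℕ) (b : WithTop ℚ≥0) : invExp (divP p b) = p * invExp b := by
  induction b with
  | top => exact (mul_zero _).symm
  | coe b => exact (inv_div b (p : ℚ≥0)).trans (div_eq_mul_inv _ _)

section Lambda

variable {p : ℕ} [Fact p.Prime] (R₀ : Type*) [CommRing R₀] [Algebra ℤ_[p] R₀] (u : R₀)
  (w : PowSystem p)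

/-- The ideal of `R₀ ⊗ A_inf` generated by `u ∈ R₀` and by the ideal of definition
`(p, [ϖ])` of `A_inf`. -/
def tensorIdeal : Ideal (R₀ ⊗[ℤ_[p]] Ainf p) :=
  Ideal.span {u ⊗ₜ 1, 1 ⊗ₜ (p : Ainf p), 1 ⊗ₜ w.teich 1}

/-- The completed tensor product of `R₀` (with its `u`-adic topology) and `A_inf` (with its
`(p, [ϖ])`-adic topology) over `ℤ_p`. -/
def CTensor : Type _ := AdicCompletion (tensorIdeal R₀ u w) (R₀ ⊗[ℤ_[p]] Ainf p)

instance : CommRing (CTensor R₀ u w) :=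
  inferInstanceAs (CommRing (AdicCompletion (tensorIdeal R₀ u w) (R₀ ⊗[ℤ_[p]] Ainf p)))

instance : Algebra R₀ (CTensor R₀ u w) :=
  inferInstanceAs (Algebra R₀ (AdicCompletion (tensorIdeal R₀ u w) (R₀ ⊗[ℤ_[p]] Ainf p)))

instance : Algebra (R₀ ⊗[ℤ_[p]] Ainf p) (CTensor R₀ u w) :=
  inferInstanceAs (Algebra (R₀ ⊗[ℤ_[p]] Ainf p)
    (AdicCompletion (tensorIdeal R₀ u w) (R₀ ⊗[ℤ_[p]] Ainf p)))

/-- The ideal of definition `(u, p, [ϖ])` of the completed tensor product. -/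
abbrev cIdeal : Ideal (CTensor R₀ u w) :=
  (tensorIdeal R₀ u w).map (algebraMap (R₀ ⊗[ℤ_[p]] Ainf p) (CTensor R₀ u w))

/-- The element `x ⊗ a` of the completed tensor product. -/
abbrev cTmul (x : R₀) (a : Ainf p) : CTensor R₀ u w :=
  algebraMap (R₀ ⊗[ℤ_[p]] Ainf p) (CTensor R₀ u w) (x ⊗ₜ a)

/-- `Λ̃_{R₀,[0,b],0} = (R₀ ⊗̂ A_inf)⟨u / [ϖ] ^ (1 / b)⟩`, for `0 < b ≤ ∞`. -/
abbrev LambdaInt (b : WithTop ℚ≥0) : Type _ :=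
  RatLoc (cIdeal R₀ u w) (cTmul R₀ u w u 1) (cTmul R₀ u w 1 (w.teich (invExp b)))

/-- The Frobenius `1 ⊗ φ` of `R₀ ⊗ A_inf`. -/
def frobT : (R₀ ⊗[ℤ_[p]] Ainf p) →ₐ[R₀] (R₀ ⊗[ℤ_[p]] Ainf p) :=
  Algebra.TensorProduct.map (AlgHom.id R₀ R₀) (frobAinf p)

theorem frobT_map_le : (tensorIdeal R₀ u w).map (frobT R₀) ≤ tensorIdeal R₀ u w := by
  rw [tensorIdeal, Ideal.map_span, Ideal.span_le]
  rintro _ ⟨x, rfl | rfl | rfl, rfl⟩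
  · exact Ideal.subset_span (by simp [frobT])
  · exact Ideal.subset_span (by simp [frobT])
  · have hp : p ≠ 0 := (Fact.out : p.Prime).ne_zero
    have h : frobT R₀ ((1 : R₀) ⊗ₜ w.teich 1) = ((1 : R₀) ⊗ₜ[ℤ_[p]] w.teich 1) ^ p := by
      rw [Algebra.TensorProduct.tmul_pow, one_pow, ← w.teich_nat_mul, ← w.frob_teich]
      rfl
    rw [SetLike.mem_coe, h]
    exact Ideal.pow_mem_of_mem _ (Ideal.subset_span (by simp)) p (Nat.pos_of_ne_zero hp)

/-- The Frobenius of `R₀ ⊗̂ A_inf`: the `R₀`-algebra map induced by the Frobenius of `A_inf`. -/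
def frobC : CTensor R₀ u w →ₐ[R₀] CTensor R₀ u w :=
  adicMap (tensorIdeal R₀ u w) (tensorIdeal R₀ u w) (frobT R₀) (frobT_map_le R₀ u w)

theorem frobC_cTmul (x : R₀) (a : Ainf p) :
    frobC R₀ u w (cTmul R₀ u w x a) = cTmul R₀ u w x (frobAinf p a) :=
  adicMap_of (tensorIdeal R₀ u w) (tensorIdeal R₀ u w) (frobT R₀) (frobT_map_le R₀ u w) (x ⊗ₜ a)

theorem frobC_map_le : (cIdeal R₀ u w).map (frobC R₀ u w) ≤ cIdeal R₀ u w := by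
  rw [Ideal.map_le_iff_le_comap, cIdeal, Ideal.map_le_iff_le_comap]
  intro x hx
  have h : frobC R₀ u w (algebraMap _ (CTensor R₀ u w) x) = algebraMap _ _ (frobT R₀ x) :=
    adicMap_of _ _ _ _ _
  rw [Ideal.mem_comap, Ideal.mem_comap, h]
  exact Ideal.mem_map_of_mem _ (frobT_map_le R₀ u w (Ideal.mem_map_of_mem _ hx))

/-- `φ : Λ̃_{R₀,[0,b],0} → Λ̃_{R₀,[0,b/p],0}`, the `R₀`-algebra map given by the Frobenius on
`R₀ ⊗̂ A_inf`; it sends `u / [ϖ] ^ (1 / b)` to `u / [ϖ] ^ (p / b)`. -/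
def phi (b : WithTop ℚ≥0) : LambdaInt R₀ u w b →ₐ[R₀] LambdaInt R₀ u w (divP p b) :=
  ratMap (frobC R₀ u w) (frobC_map_le R₀ u w) 1
    (by rw [frobC_cTmul, map_one])
    (by rw [frobC_cTmul, mul_one, w.frob_teich, invExp_divP])

/-- The natural map `Λ̃_{R₀,[0,b],0} → Λ̃_{R₀,[0,b/p],0}`, the `R₀`-algebra map given by the
identity on `R₀ ⊗̂ A_inf`; it sends `u / [ϖ] ^ (1 / b)` to
`[ϖ] ^ ((p - 1) / b) * (u / [ϖ] ^ (p / b))`. -/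
def incl (b : WithTop ℚ≥0) : LambdaInt R₀ u w b →ₐ[R₀] LambdaInt R₀ u w (divP p b) :=
  ratMap (AlgHom.id R₀ _) (Ideal.map_id _).le
    (cTmul R₀ u w 1 (w.teich ((p - 1 : ℕ) * invExp b))) rfl (by
      rw [AlgHom.id_apply, cTmul, cTmul, ← map_mul, Algebra.TensorProduct.tmul_mul_tmul, one_mul,
        ← w.teich_add, ← one_add_mul, invExp_divP, ← Nat.cast_one_add,
        Nat.add_sub_cancel' (Fact.out : p.Prime).one_lt.le])

/-- The `R₀`-linear map `φ - 1 : Λ̃_{R₀,[0,b],0} → Λ̃_{R₀,[0,b/p],0}`, where `1` is the natural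
map. -/
def phiSubOne (b : WithTop ℚ≥0) : LambdaInt R₀ u w b →ₗ[R₀] LambdaInt R₀ u w (divP p b) :=
  (phi R₀ u w b).toLinearMap - (incl R₀ u w b).toLinearMap

end Lambda

end PseudoRigid

end

open scoped TensorProduct

noncomputable section

namespace PseudoRigid

/-! ## Artin–Schreier equations in `O_{ℂ_p}^♭` -/

section Flat

variable {p : ℕ} [Fact p.Prime]

/-! Put `c = 1/b`. Before any completion the ring is `(R₀ ⊗ A_inf)[X] / ([ϖ]^c X - u)`. There `φ`
fixes `X` while the natural map sends `X` to `[ϖ]^((p-1)c) X`, so `φ - 1` acts degree by degree: on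
coefficients of `X^k` it is the base change to `R₀` of `φ - [ϖ]^((p-1)kc)` on `A_inf`. The problem
thus reduces to semilinear equations over `A_inf`, and modulo `p` to equations of Artin–Schreier
type in `O^♭`, which is a domain.

Over `A_inf`, `φ - [ϖ]^q` is surjective (`frobSub_surjective`) and the kernel of `φ - [ϖ]^((p-1)q)`
is `ℤ_p [ϖ]^q` (`exact_toSpanSingleton_frobSub`). By right exactness of the tensor product, the
kernel in degree `k` is the image of `R₀ ⊗ ℤ_p [ϖ]^(kc)`. Since `[ϖ]^(kc) X^k = u^k` in the
quotient, these kernels all land in `R₀`. The relations cause no trouble because `φ - 1` is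
surjective on polynomials and carries multiples of one relation to multiples of the other
(`polyDelta_mul`).

Completion need not preserve exactness, so two topological facts are required. First, `φ - 1` is
open: every element of the `pn`-th power of the ideal `(u, p, [ϖ])` is the image of an element of
the `n`-th power (`exists_mem_pow_deltaT_eq`). Second, the topology induced on `R₀` is `u`-adic
(`exists_forall_mem_pow_of_algebraMap_mem`). The second is seen by substituting `X = u/[ϖ]^c` and
clearing denominators, together with the purity of `ℤ_p [ϖ]^q` in a quotient of `A_inf`
(`tmul_teich_injective`). As `p` is topologically nilpotent in `R₀` and `R₀` is `u`-adically
complete, exactness passes to the completion, which is identified with `Λ̃` by `toLambda_bijective`.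
-/

theorem exists_root_of_monic {f : Polynomial 𝓞_ℂ_[p]} (hf : f.Monic) (hd : f.natDegree ≠ 0) :
    ∃ y : 𝓞_ℂ_[p], f.eval y = 0 := by
  obtain ⟨z, hz⟩ := IsAlgClosed.exists_root (f.map (algebraMap 𝓞_ℂ_[p] ℂ_[p]))
    (by rw [hf.degree_map]; exact fun h ↦ hd (Polynomial.natDegree_eq_of_degree_eq_some h))
  rw [Polynomial.IsRoot.def, Polynomial.eval_map] at hz
  obtain ⟨y, rfl⟩ := IsIntegrallyClosed.isIntegral_iff.1 (⟨f, hf, hz⟩ : IsIntegral 𝓞_ℂ_[p] z)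
  refine ⟨y, IsFractionRing.injective 𝓞_ℂ_[p] ℂ_[p] ?_⟩
  rw [map_zero, ← hz, Polynomial.eval₂_at_apply]

theorem exists_pow_sub_mul_eq (t a : 𝓞_ℂ_[p]) : ∃ y : 𝓞_ℂ_[p], y ^ p - t * y = a := by
  have hp : 1 < p := (Fact.out : p.Prime).one_lt
  let g : Polynomial 𝓞_ℂ_[p] := Polynomial.C (-t) * Polynomial.X + Polynomial.C (-a)
  have hg : g.degree < p := Polynomial.degree_linear_le.trans_lt (by exact_mod_cast hp)
  have hd : (Polynomial.X ^ p + g).natDegree = p := by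
    refine Polynomial.natDegree_eq_of_degree_eq_some ?_
    rw [Polynomial.degree_add_eq_left_of_degree_lt, Polynomial.degree_X_pow]
    rwa [Polynomial.degree_X_pow]
  obtain ⟨y, hy⟩ := exists_root_of_monic (Polynomial.monic_X_pow_add hg) (by omega)
  refine ⟨y, ?_⟩
  simp only [g, Polynomial.eval_add, Polynomial.eval_pow, Polynomial.eval_X, Polynomial.eval_mul,
    Polynomial.eval_C] at hy
  linear_combination hy

theorem modP_frobenius_surjective : Function.Surjective (frobenius (ModP 𝓞_ℂ_[p] p) p) := by
  intro a
  obtain ⟨a, rfl⟩ := Ideal.Quotient.mk_surjective a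
  obtain ⟨y, hy⟩ := exists_pow_sub_mul_eq 0 a
  exact ⟨Ideal.Quotient.mk _ y, by rw [frobenius_def, ← map_pow, ← hy, zero_mul, sub_zero]⟩

theorem coeff_zero_surjective :
    Function.Surjective (PreTilt.coeff 0 : OFlat p →+* ModP 𝓞_ℂ_[p] p) :=
  Perfection.coeff_surjective modP_frobenius_surjective 0

theorem exists_coeff_eq (f : ℕ → ModP 𝓞_ℂ_[p] p) (hf : ∀ n, f (n + 1) ^ p = f n) :
    ∃ x : OFlat p, ∀ n, PreTilt.coeff n x = f n :=
  ⟨(⟨f, hf⟩ : Perfection (ModP 𝓞_ℂ_[p] p) p), fun _ ↦ rfl⟩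

theorem flat_ext {x y : OFlat p} (h : ∀ n, PreTilt.coeff n x = PreTilt.coeff n y) : x = y :=
  Perfection.ext h

instance : IsDomain (OFlat p) :=
  PreTilt.isDomain ℂ_[p] _ _ (PadicComplexInt.integers p) p

theorem coeff_varpi (w : PowSystem p) (q : ℚ≥0) (n : ℕ) :
    PreTilt.coeff n (w.varpi q) = Ideal.Quotient.mk _ (w.pow (q / p ^ n)) := rfl

theorem mk_eq_zero_iff_dvd (x : 𝓞_ℂ_[p]) :
    (Ideal.Quotient.mk _ x : ModP 𝓞_ℂ_[p] p) = 0 ↔ (p : 𝓞_ℂ_[p]) ∣ x := by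
  rw [Ideal.Quotient.eq_zero_iff_mem, Ideal.mem_span_singleton]

theorem natCast_p_ne_zero : (p : 𝓞_ℂ_[p]) ≠ 0 := by
  intro h
  have h2 := congrArg (algebraMap 𝓞_ℂ_[p] ℂ_[p]) h
  rw [map_natCast, map_zero] at h2
  exact (Fact.out : p.Prime).ne_zero (by exact_mod_cast h2)

/-! ### Divisibility by the elements `ϖ^q` -/

namespace PowSystem

variable (w : PowSystem p)

theorem pow_natCast (n : ℕ) : w.pow n = (p : 𝓞_ℂ_[p]) ^ n := by
  rw [← mul_one (n : ℚ≥0), w.pow_nat_mul, w.pow_one]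

theorem pow_dvd_pow {q r : ℚ≥0} (h : q ≤ r) : w.pow q ∣ w.pow r :=
  ⟨w.pow (r - q), by rw [← w.pow_add, add_tsub_cancel_of_le h]⟩

theorem pow_ne_zero (q : ℚ≥0) : w.pow q ≠ 0 := by
  obtain ⟨n, hn⟩ := exists_nat_ge q
  intro h
  have := w.pow_dvd_pow hn
  rw [h, zero_dvd_iff, w.pow_natCast] at this
  exact _root_.pow_ne_zero n natCast_p_ne_zero this

theorem exists_p_dvd_pow_pow {q : ℚ≥0} (hq : 0 < q) : ∃ n : ℕ, (p : 𝓞_ℂ_[p]) ∣ w.pow q ^ n := by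
  obtain ⟨n, hn⟩ := exists_nat_ge (1 / q)
  refine ⟨n, ?_⟩
  rw [← w.pow_nat_mul, ← w.pow_one]
  exact w.pow_dvd_pow ((div_le_iff₀ hq).1 hn)

theorem pow_not_isUnit {q : ℚ≥0} (hq : 0 < q) : ¬ IsUnit (w.pow q) := by
  intro h
  obtain ⟨n, hn⟩ := w.exists_p_dvd_pow_pow hq
  exact (Fact.out : ¬ IsUnit (p : 𝓞_ℂ_[p])) (isUnit_of_dvd_unit hn (h.pow n))

theorem varpi_ne_zero (q : ℚ≥0) : w.varpi q ≠ 0 := by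
  have hp := (Fact.out : p.Prime).one_lt
  obtain ⟨n, hn⟩ := pow_unbounded_of_one_lt q (show (1 : ℚ≥0) < p by exact_mod_cast hp)
  intro h
  have h1 : q / p ^ n < 1 := (div_lt_one (by positivity)).2 hn
  have h2 := congrArg (PreTilt.coeff n) h
  rw [coeff_varpi, map_zero, mk_eq_zero_iff_dvd] at h2
  obtain ⟨c, hc⟩ := h2
  rw [← w.pow_one, ← add_tsub_cancel_of_le h1.le, w.pow_add, mul_assoc,
    eq_comm, mul_eq_left₀ (w.pow_ne_zero _)] at hc
  exact w.pow_not_isUnit (tsub_pos_of_lt h1) (IsUnit.of_mul_eq_one _ hc)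

theorem varpi_not_isUnit {q : ℚ≥0} (hq : 0 < q) : ¬ IsUnit (w.varpi q) := by
  intro h
  obtain ⟨n, hn⟩ := w.exists_p_dvd_pow_pow hq
  have h2 := (h.map (PreTilt.coeff 0)).pow n
  rw [coeff_varpi, _root_.pow_zero, div_one, ← map_pow, (mk_eq_zero_iff_dvd _).2 hn] at h2
  exact not_isUnit_zero h2

theorem isNilpotent_coeff_zero_varpi {q : ℚ≥0} (hq : 0 < q) :
    IsNilpotent (PreTilt.coeff 0 (w.varpi q)) := by
  obtain ⟨n, hn⟩ := w.exists_p_dvd_pow_pow hq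
  refine ⟨n, ?_⟩
  rw [coeff_varpi, _root_.pow_zero, div_one, ← map_pow, (mk_eq_zero_iff_dvd _).2 hn]

theorem varpi_pow_p (q : ℚ≥0) : w.varpi q ^ p = w.varpi (p * q) := (w.varpi_nat_mul p q).symm

/-- An element of `O^♭` vanishing in `O / p` is a multiple of `ϖ`. -/
theorem varpi_one_dvd {x : OFlat p} (hx : PreTilt.coeff 0 x = 0) : w.varpi 1 ∣ x := by
  have hp : p.Prime := Fact.out
  have hp0 : (p : ℚ≥0) ≠ 0 := by exact_mod_cast hp.ne_zero
  choose E hE using fun n ↦ Ideal.Quotient.mk_surjective (PreTilt.coeff n x)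
  have hP (n : ℕ) : w.pow (1 / p ^ n) ^ p ^ n = p := by
    rw [← w.pow_nat_mul, ← w.pow_one]
    congr 1
    push_cast
    field_simp
  have hpow (n : ℕ) : PreTilt.coeff n x ^ p ^ n = 0 := by
    induction n with
    | zero => rw [hx, zero_pow (by simp)]
    | succ n ih => rw [pow_succ', pow_mul, PreTilt.coeff_pow_p, ih]
  -- `p = (p^(1/p^n))^(p^n)` divides `E n ^ (p^n)`, and in an integrally closed domain divisibility
  -- of powers descends to the bases.
  have hdvd (n : ℕ) : w.pow (1 / p ^ n) ∣ E n := by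
    rw [← IsIntegrallyClosed.pow_dvd_pow_iff (pow_pos hp.pos n).ne', hP, ← mk_eq_zero_iff_dvd,
      map_pow, hE, hpow]
  choose Z hZ using hdvd
  have hQ (n : ℕ) : w.pow (1 / p ^ (n + 1)) ^ p = w.pow (1 / p ^ n) := by
    rw [← w.pow_nat_mul]
    congr 1
    rw [pow_succ]
    field_simp
  -- Dividing out `p^(1/p^(n+1))` loses precision, but a factor `p^(1/p)` of the congruence modulo
  -- `p` survives. The index starts at `1` because nothing would be left at index `0`.
  have hdiv (n : ℕ) : w.pow (1 / p) ∣ Z (n + 2) ^ p - Z (n + 1) := by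
    have h1 : (p : 𝓞_ℂ_[p]) ∣ E (n + 2) ^ p - E (n + 1) := by
      rw [← mk_eq_zero_iff_dvd, map_sub, map_pow, hE, hE, PreTilt.coeff_pow_p, sub_self]
    rw [hZ, hZ, mul_pow, hQ, ← mul_sub] at h1
    have hle : (1 / p ^ (n + 1) + 1 / p : ℚ≥0) ≤ 1 := by
      have h2 : (2 : ℚ≥0) ≤ p := by exact_mod_cast hp.two_le
      have h3 : (1 / p : ℚ≥0) ≤ 1 / 2 := one_div_le_one_div_of_le (by norm_num) h2
      have h4 : (1 / p ^ (n + 1) : ℚ≥0) ≤ 1 / p :=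
        one_div_le_one_div_of_le (by positivity)
          (le_self_pow₀ (by exact_mod_cast hp.one_lt.le) n.succ_ne_zero)
      calc (1 / p ^ (n + 1) + 1 / p : ℚ≥0) ≤ 1 / 2 + 1 / 2 := add_le_add (h4.trans h3) h3
        _ = 1 := by norm_num
    have h5 := (w.pow_dvd_pow hle).trans (w.pow_one ▸ h1)
    rw [w.pow_add] at h5
    exact (mul_dvd_mul_iff_left (w.pow_ne_zero _)).1 h5
  -- The `p`-th power restores the lost precision: elements congruent modulo `p^(1/p)` have `p`-th
  -- powers congruent modulo `p`.
  obtain ⟨z, hz⟩ := exists_coeff_eq (fun n ↦ (Ideal.Quotient.mk _ (Z (n + 1)) :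
      ModP 𝓞_ℂ_[p] p) ^ p) (fun n ↦ by
    obtain ⟨c, hc⟩ := hdiv n
    have h1 : (w.pow (1 / p)) ^ p = p := by simpa using hP 1
    have h2 : (Ideal.Quotient.mk _ (Z (n + 2)) : ModP 𝓞_ℂ_[p] p) ^ p =
        Ideal.Quotient.mk _ (Z (n + 1)) + Ideal.Quotient.mk _ (w.pow (1 / p) * c) := by
      rw [← hc, ← map_pow, ← map_add]
      congr 1
      ring
    rw [h2, add_pow_char, ← map_pow _ (w.pow (1 / p) * c), mul_pow, h1,
      (mk_eq_zero_iff_dvd _).2 (dvd_mul_right _ _), add_zero])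
  refine ⟨z, flat_ext fun n ↦ ?_⟩
  rw [map_mul, hz, coeff_varpi, ← hQ, map_pow, ← mul_pow, ← map_mul, ← hZ, hE,
    PreTilt.coeff_pow_p]

theorem varpi_dvd_varpi {q r : ℚ≥0} (h : q ≤ r) : w.varpi q ∣ w.varpi r :=
  ⟨w.varpi (r - q), by rw [← w.varpi_add, add_tsub_cancel_of_le h]⟩

end PowSystem

theorem exists_pow_sub_self_eq (a : OFlat p) : ∃ y : OFlat p, y ^ p - y = a := by
  obtain ⟨a₀, h₀⟩ := Ideal.Quotient.mk_surjective (PreTilt.coeff 0 a)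
  obtain ⟨y₀, hy₀⟩ := exists_pow_sub_mul_eq 1 a₀
  -- Compatibility `y_(n+1)^p = y_n` turns the equation at level `n + 1` into `y_(n+1) = y_n -
  -- a_(n+1)`, so a solution at level `0` determines all the others.
  let f : ℕ → ModP 𝓞_ℂ_[p] p := fun n ↦
    Nat.rec (Ideal.Quotient.mk _ y₀) (fun n y ↦ y - PreTilt.coeff (n + 1) a) n
  have hf (n : ℕ) : f n ^ p - f n = PreTilt.coeff n a := by
    induction n with
    | zero =>
      change Ideal.Quotient.mk _ y₀ ^ p - Ideal.Quotient.mk _ y₀ = _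
      rw [← h₀, ← hy₀, one_mul, map_sub, map_pow]
    | succ n ih =>
      change (f n - PreTilt.coeff (n + 1) a) ^ p - (f n - PreTilt.coeff (n + 1) a) = _
      rw [sub_pow_char, PreTilt.coeff_pow_p, ← ih]
      ring
  obtain ⟨y, hy⟩ := exists_coeff_eq f (fun n ↦ by
    change (f n - PreTilt.coeff (n + 1) a) ^ p = f n
    rw [sub_pow_char, PreTilt.coeff_pow_p, ← hf]
    ring)
  exact ⟨y, flat_ext fun n ↦ by rw [map_sub, map_pow, hy, hf]⟩

theorem exists_eq_add_mul_pow_of_isNilpotent {A : Type*} [CommRing A] {t : A} (ht : IsNilpotent t)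
    (a : A) (n : ℕ) : ∃ y, y = a + t * y ^ n := by
  obtain ⟨N, hN⟩ := ht
  have h (k : ℕ) : ∃ y, t ^ k ∣ y - (a + t * y ^ n) := by
    induction k with
    | zero => exact ⟨0, by simp⟩
    | succ k ih =>
      obtain ⟨y, hy⟩ := ih
      refine ⟨a + t * y ^ n, ?_⟩
      have h1 : a + t * y ^ n - (a + t * (a + t * y ^ n) ^ n) =
          t * (y ^ n - (a + t * y ^ n) ^ n) := by ring
      rw [h1, pow_succ']
      exact mul_dvd_mul_left _ (hy.trans (sub_dvd_pow_sub_pow _ _ _))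
  obtain ⟨y, hy⟩ := h N
  rw [hN, zero_dvd_iff, sub_eq_zero] at hy
  exact ⟨y, hy⟩

variable (w : PowSystem p)

theorem exists_sub_varpi_mul_pow_eq {q : ℚ≥0} (hq : 0 < q) (a : OFlat p) :
    ∃ y : OFlat p, y - w.varpi q * y ^ p = a := by
  -- In `O/p` the image of `ϖ^q` is nilpotent, so fixed-point iteration terminates. Higher levels
  -- are then forced by `y_(n+1)^p = y_n`.
  obtain ⟨y₀, hy₀⟩ := exists_eq_add_mul_pow_of_isNilpotent
    (w.isNilpotent_coeff_zero_varpi hq) (PreTilt.coeff 0 a) p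
  let f : ℕ → ModP 𝓞_ℂ_[p] p := fun n ↦
    Nat.rec y₀ (fun n y ↦ PreTilt.coeff (n + 1) a + PreTilt.coeff (n + 1) (w.varpi q) * y) n
  have hs (n : ℕ) : f (n + 1) = PreTilt.coeff (n + 1) a +
    PreTilt.coeff (n + 1) (w.varpi q) * f n := rfl
  have hf' (n : ℕ) : f (n + 1) ^ p = PreTilt.coeff n a + PreTilt.coeff n (w.varpi q) * f n ^ p := by
    rw [hs, add_pow_char, mul_pow, PreTilt.coeff_pow_p, PreTilt.coeff_pow_p]
  have hf (n : ℕ) : f n = PreTilt.coeff n a + PreTilt.coeff n (w.varpi q) * f n ^ p := by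
    induction n with
    | zero => exact hy₀
    | succ n ih => rw [hf', ← ih, hs]
  obtain ⟨y, hy⟩ := exists_coeff_eq f (fun n ↦ by rw [hf', ← hf])
  exact ⟨y, flat_ext fun n ↦ by rw [map_sub, map_mul, map_pow, hy, sub_eq_iff_eq_add]; exact hf n⟩

/-- With the exponent written as `(p-1)q`, the substitution `y = ϖ^q z` turns the left side into
`ϖ^(pq) (z^p - z)`. When `pq ≤ 1` this corrects a solution modulo `ϖ`; larger `q` are reduced to
this case by repeated division by `p`. -/
theorem exists_pow_sub_varpi_mul_eq (q : ℚ≥0) (a : OFlat p) :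
    ∃ y : OFlat p, y ^ p - w.varpi ((p - 1 : ℕ) * q) * y = a := by
  have hp : p.Prime := Fact.out
  have hp0 : (p : ℚ≥0) ≠ 0 := by exact_mod_cast hp.ne_zero
  have hpq (q : ℚ≥0) : p * q = (p - 1 : ℕ) * q + q := by
    conv_lhs => rw [← Nat.sub_add_cancel hp.one_lt.le, Nat.cast_add, add_mul, Nat.cast_one, one_mul]
  obtain ⟨k, hk⟩ := pow_unbounded_of_one_lt (p * q)
    (show (1 : ℚ≥0) < p by exact_mod_cast hp.one_lt)
  replace hk := hk.le
  induction k generalizing q a with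
  | zero =>
    obtain ⟨a₀, h₀⟩ := Ideal.Quotient.mk_surjective (PreTilt.coeff 0 a)
    obtain ⟨y₀, hy₀⟩ := exists_pow_sub_mul_eq (w.pow ((p - 1 : ℕ) * q)) a₀
    obtain ⟨y, hy⟩ := coeff_zero_surjective (Ideal.Quotient.mk _ y₀)
    obtain ⟨e, he⟩ : w.varpi (p * q) ∣ a - (y ^ p - w.varpi ((p - 1 : ℕ) * q) * y) := by
      refine (w.varpi_dvd_varpi (by simpa using hk)).trans (w.varpi_one_dvd ?_)
      rw [map_sub, map_sub, map_mul, map_pow, hy, coeff_varpi, pow_zero, div_one, ← map_pow,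
        ← map_mul, ← map_sub, hy₀, h₀, sub_self]
    obtain ⟨z, hz⟩ := exists_pow_sub_self_eq e
    refine ⟨y + w.varpi q * z, ?_⟩
    rw [add_pow_char, mul_pow, w.varpi_pow_p]
    have h1 : w.varpi (p * q) = w.varpi ((p - 1 : ℕ) * q) * w.varpi q := by
      rw [← w.varpi_add, hpq]
    linear_combination (-1) * he + w.varpi (p * q) * hz + z * h1
  | succ k ih =>
    -- Extract a `p`-th root of the right side: for `y = a^(1/p) + ϖ^((p-1)q/p) z` the equation
    -- becomes the same one for `z`, with `q/p` and `a^(1/p)` in place of `q` and `a`.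
    obtain ⟨z, hz⟩ := ih (q / p) ((frobeniusEquiv _ p).symm a) (by
      rw [mul_div_cancel₀ _ hp0]
      rw [pow_succ'] at hk
      exact le_of_mul_le_mul_left hk (by positivity))
    refine ⟨(frobeniusEquiv _ p).symm a + w.varpi ((p - 1 : ℕ) * (q / p)) * z, ?_⟩
    have h1 : ((frobeniusEquiv _ p).symm a) ^ p = a := frobeniusEquiv_symm_pow_p _ _ _
    have h2 : (p : ℚ≥0) * ((p - 1 : ℕ) * (q / p)) = (p - 1 : ℕ) * q := by field_simp
    rw [add_pow_char, mul_pow, w.varpi_pow_p, h2, h1]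
    linear_combination w.varpi ((p - 1 : ℕ) * q) * hz

theorem exists_natCast_of_pow_p_eq_self {K : Type*} [Field K] [CharP K p] {x : K} (hx : x ^ p = x) :
    ∃ n : ℕ, x = n := by
  have hp : p.Prime := Fact.out
  let := ZMod.algebra K p
  have h1 : (Polynomial.X ^ p - Polynomial.X : Polynomial K) ≠ 0 :=
    FiniteField.X_pow_card_sub_X_ne_zero K hp.one_lt
  have h3 := (Polynomial.card_roots' (Polynomial.X ^ p - Polynomial.X : Polynomial K))
  rw [FiniteField.X_pow_card_sub_X_natDegree_eq K hp.one_lt] at h3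
  classical
  let S : Finset K := (Finset.range p).image (fun n : ℕ ↦ (n : K))
  have hS : S.card = p := by
    rw [Finset.card_image_of_injOn, Finset.card_range]
    intro a ha b hb hab
    simp only [Finset.coe_range, Set.mem_Iio] at ha hb
    exact CharP.natCast_injOn_Iio K p ha hb hab
  have hsub : S ⊆ (Polynomial.X ^ p - Polynomial.X : Polynomial K).roots.toFinset := by
    intro s hs
    obtain ⟨n, -, rfl⟩ := Finset.mem_image.1 hs
    rw [Multiset.mem_toFinset, Polynomial.mem_roots h1, Polynomial.IsRoot, Polynomial.eval_sub,
      Polynomial.eval_pow, Polynomial.eval_X, ← frobenius_def, map_natCast, sub_self]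
  have heq := Finset.eq_of_subset_of_card_le hsub
    ((Multiset.toFinset_card_le _).trans (h3.trans hS.ge))
  have hxS : x ∈ S := by
    rw [heq, Multiset.mem_toFinset, Polynomial.mem_roots h1]
    simp [hx]
  obtain ⟨n, -, hn⟩ := Finset.mem_image.1 hxS
  exact ⟨n, hn.symm⟩

/-- In the fraction field, `y / ϖ^q` is a root of `X^p - X`, hence lies in the prime field. -/
theorem eq_natCast_mul_varpi {q : ℚ≥0} {y : OFlat p}
    (hy : y ^ p = w.varpi ((p - 1 : ℕ) * q) * y) : ∃ n : ℕ, y = n * w.varpi q := by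
  have hp : p.Prime := Fact.out
  let K := FractionRing (OFlat p)
  have : CharP K p := charP_of_injective_algebraMap (IsFractionRing.injective (OFlat p) K) p
  have h0 : algebraMap (OFlat p) K (w.varpi q) ≠ 0 := fun h ↦ w.varpi_ne_zero q
    (IsFractionRing.injective (OFlat p) K (by rw [h, map_zero]))
  obtain ⟨n, hn⟩ := exists_natCast_of_pow_p_eq_self (p := p)
    (x := algebraMap (OFlat p) K y / algebraMap (OFlat p) K (w.varpi q)) (by
      rw [div_pow, ← map_pow, hy, map_mul, w.varpi_nat_mul, map_pow,
        div_eq_div_iff (pow_ne_zero _ h0) h0, mul_right_comm, ← pow_succ,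
        Nat.sub_add_cancel hp.one_lt.le, mul_comm])
  refine ⟨n, IsFractionRing.injective (OFlat p) K ?_⟩
  rw [map_mul, map_natCast, ← hn, div_mul_cancel₀ _ h0]

end Flat

/-! ## Frobenius equations in `A_inf` -/

/-! ### Successive approximation along a principal ideal -/

section Lifting

variable {S M N : Type*} [CommRing S] [AddCommGroup M] [Module S M] [AddCommGroup N] [Module S N]

theorem pow_smul_mem_span_pow_smul_top (ϖ : S) (n : ℕ) (x : M) :
    ϖ ^ n • x ∈ (Ideal.span {ϖ} ^ n • ⊤ : Submodule S M) :=
  Submodule.smul_mem_smul (Ideal.pow_mem_pow (Ideal.mem_span_singleton_self _) n) trivial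

/-- A submodule `K` of `N` lies in the range of `G : M → N` as soon as it does so up to `ϖ K`. -/
theorem le_range_of_forall_eq_add_smul (ϖ : S) [IsPrecomplete (Ideal.span {ϖ}) M]
    [IsHausdorff (Ideal.span {ϖ}) N] (G : M →ₗ[S] N) (K : Submodule S N)
    (h : ∀ a ∈ K, ∃ y, ∃ a' ∈ K, a = G y + ϖ • a') : K ≤ LinearMap.range G := by
  intro a ha
  choose! y a' ha' hy using h
  let s : ℕ → N := fun n ↦ a'^[n] a
  have hs (n : ℕ) : s n ∈ K := by
    induction n with
    | zero => exact ha
    | succ n ih => simpa only [s, Function.iterate_succ_apply'] using ha' _ ih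
  let P : ℕ → M := fun n ↦ ∑ i ∈ Finset.range n, ϖ ^ i • y (s i)
  have hP (n : ℕ) : a = G (P n) + ϖ ^ n • s n := by
    induction n with
    | zero => simp [P, s]
    | succ n ih =>
      have h1 : s n = G (y (s n)) + ϖ • s (n + 1) := by
        simpa only [s, Function.iterate_succ_apply'] using hy _ (hs n)
      rw [ih]
      conv_lhs => rw [h1]
      simp only [P, Finset.sum_range_succ, map_add, map_smul, smul_add, pow_succ, mul_smul, add_assoc]
  obtain ⟨L, hL⟩ := IsPrecomplete.prec (I := Ideal.span {ϖ}) inferInstance (f := P) (by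
    intro m n hmn
    rw [SModEq.comm, SModEq.sub_mem]
    simp only [P]
    rw [← Finset.sum_Ico_eq_sub _ hmn]
    refine Submodule.sum_mem _ fun i hi ↦ ?_
    rw [← Nat.add_sub_cancel' (Finset.mem_Ico.1 hi).1, pow_add, mul_smul]
    exact pow_smul_mem_span_pow_smul_top _ _ _)
  refine ⟨L, sub_eq_zero.1 (IsHausdorff.haus (I := Ideal.span {ϖ}) inferInstance _ fun n ↦ ?_)⟩
  rw [SModEq.zero]
  have h2 : G L - a = -(G (P n - L)) - ϖ ^ n • s n := by
    conv_lhs => rw [hP n]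
    rw [map_sub]
    abel
  rw [h2]
  refine Submodule.sub_mem _ (Submodule.neg_mem _ ?_) (pow_smul_mem_span_pow_smul_top _ _ _)
  have h3 := Submodule.mem_map_of_mem (f := G) (SModEq.sub_mem.1 (hL n))
  rw [Submodule.map_smul''] at h3
  exact Submodule.smul_mono le_rfl le_top h3

end Lifting

/-! ### Surjectivity and kernel of `φ - [ϖ]^q` -/

section Ainf

variable {p : ℕ} [Fact p.Prime]

theorem coeff_zero_frobAinf (x : Ainf p) :
    WittVector.constantCoeff (frobAinf p x) = WittVector.constantCoeff x ^ p :=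
  WittVector.coeff_frobenius_charP p x 0

theorem coeff_zero_teich (w : PowSystem p) (q : ℚ≥0) :
    WittVector.constantCoeff (w.teich q) = w.varpi q :=
  WittVector.teichmuller_coeff_zero p _

theorem p_dvd_iff (x : Ainf p) : (p : Ainf p) ∣ x ↔ WittVector.constantCoeff x = 0 := by
  rw [← Ideal.mem_span_singleton]
  exact WittVector.mem_span_p_iff_coeff_zero_eq_zero x

theorem coeff_zero_Ainf_surjective :
    Function.Surjective (WittVector.constantCoeff : Ainf p →+* OFlat p) := fun x ↦
  ⟨WittVector.teichmuller p x, WittVector.teichmuller_coeff_zero p x⟩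

theorem smul_eq_p_mul (x : Ainf p) : (p : ℤ_[p]) • x = p * x := by
  rw [Algebra.smul_def, map_natCast]

theorem teich_ne_zero (w : PowSystem p) (q : ℚ≥0) : w.teich q ≠ 0 := fun h ↦
  w.varpi_ne_zero q (by rw [← coeff_zero_teich, h, map_zero])

theorem p_ne_zero_Ainf : (p : Ainf p) ≠ 0 := by
  intro h
  have := WittVector.eq_zero_of_p_mul_eq_zero (1 : Ainf p) (by rw [one_mul, h])
  exact one_ne_zero this

theorem map_span_p : (Ideal.span {(p : ℤ_[p])}).map (algebraMap ℤ_[p] (Ainf p)) =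
    Ideal.span {(p : Ainf p)} := by
  rw [Ideal.map_span, Set.image_singleton, map_natCast]

instance : IsHausdorff (Ideal.span {(p : ℤ_[p])}) (Ainf p) := by
  rw [← IsHausdorff.map_algebraMap_iff (S := Ainf p), map_span_p]
  infer_instance

instance : IsPrecomplete (Ideal.span {(p : ℤ_[p])}) (Ainf p) := by
  rw [← IsPrecomplete.map_algebraMap_iff (S := Ainf p), map_span_p]
  infer_instance

instance : IsPrecomplete (Ideal.span {(p : ℤ_[p])}) ℤ_[p] := by
  rw [← PadicInt.maximalIdeal_eq_span_p]
  infer_instance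

theorem surjective_of_forall_p_dvd (G : Ainf p →ₗ[ℤ_[p]] Ainf p)
    (h : ∀ a : Ainf p, ∃ y, WittVector.constantCoeff (G y) = WittVector.constantCoeff a) :
    Function.Surjective G := by
  rw [← LinearMap.range_eq_top, ← top_le_iff]
  refine le_range_of_forall_eq_add_smul (p : ℤ_[p]) G (⊤ : Submodule ℤ_[p] (Ainf p)) fun a _ ↦ ?_
  obtain ⟨y, hy⟩ := h a
  obtain ⟨a', ha'⟩ := (p_dvd_iff (a - G y)).2 (by rw [map_sub, hy, sub_self])
  exact ⟨y, a', trivial, by rw [smul_eq_p_mul, ← ha', add_sub_cancel]⟩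

variable (w : PowSystem p)

/-- The `ℤ_p`-linear map `φ - [ϖ] ^ q` on `A_inf`. -/
def frobSub (q : ℚ≥0) : Ainf p →ₗ[ℤ_[p]] Ainf p :=
  (frobAinf p).toLinearMap - LinearMap.mulLeft ℤ_[p] (w.teich q)

theorem frobSub_apply (q : ℚ≥0) (y : Ainf p) :
    frobSub w q y = frobAinf p y - w.teich q * y := rfl

theorem frobSub_surjective (q : ℚ≥0) : Function.Surjective (frobSub w q) := by
  have hp : p.Prime := Fact.out
  refine surjective_of_forall_p_dvd _ fun a ↦ ?_
  obtain ⟨y, hy⟩ := exists_pow_sub_varpi_mul_eq w (q / (p - 1 : ℕ)) (WittVector.constantCoeff a)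
  obtain ⟨y, rfl⟩ := coeff_zero_Ainf_surjective y
  refine ⟨y, ?_⟩
  have h0 : ((p - 1 : ℕ) : ℚ≥0) ≠ 0 := by exact_mod_cast (Nat.sub_pos_of_lt hp.one_lt).ne'
  rw [mul_div_cancel₀ _ h0] at hy
  rw [frobSub_apply, map_sub, map_mul, coeff_zero_frobAinf, coeff_zero_teich, hy]

theorem exists_sub_teich_mul_frob_eq {q : ℚ≥0} (hq : 0 < q) (a : Ainf p) :
    ∃ y : Ainf p, y - w.teich q * frobAinf p y = a := by
  refine surjective_of_forall_p_dvd
    (LinearMap.id - LinearMap.mulLeft ℤ_[p] (w.teich q) ∘ₗ (frobAinf p).toLinearMap) (fun a ↦ ?_) a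
  obtain ⟨y, hy⟩ := exists_sub_varpi_mul_pow_eq w hq (WittVector.constantCoeff a)
  obtain ⟨y, rfl⟩ := coeff_zero_Ainf_surjective y
  refine ⟨y, ?_⟩
  change WittVector.constantCoeff (y - w.teich q * frobAinf p y) = _
  rw [map_sub, map_mul, coeff_zero_frobAinf, coeff_zero_teich, hy]

/-- Modulo `p` a kernel element is an integer multiple of `ϖ^q`. Subtracting that multiple of
`[ϖ]^q` leaves `p a'`, and `a'` is again in the kernel because `p` is a nonzerodivisor, so
successive approximation applies. -/
theorem exact_toSpanSingleton_frobSub (q : ℚ≥0) :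
    Function.Exact (LinearMap.toSpanSingleton ℤ_[p] (Ainf p) (w.teich q))
      (frobSub w ((p - 1 : ℕ) * q)) := by
  have hp : p.Prime := Fact.out
  rw [LinearMap.exact_iff]
  refine le_antisymm (le_range_of_forall_eq_add_smul (p : ℤ_[p]) _ _ fun a ha ↦ ?_) ?_
  · rw [LinearMap.mem_ker, frobSub_apply, sub_eq_zero] at ha
    have h1 := congrArg WittVector.constantCoeff ha
    rw [coeff_zero_frobAinf, map_mul, coeff_zero_teich] at h1
    obtain ⟨n, hn⟩ := eq_natCast_mul_varpi w h1
    obtain ⟨a', ha'⟩ := (p_dvd_iff (a - (n : Ainf p) * w.teich q)).2 (by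
      rw [map_sub, map_mul, coeff_zero_teich, map_natCast, hn, sub_self])
    have h2 : a = (n : Ainf p) * w.teich q + p * a' := by rw [← ha', add_sub_cancel]
    refine ⟨n, a', ?_, ?_⟩
    · rw [LinearMap.mem_ker, frobSub_apply]
      rw [h2, map_add, map_mul, map_mul, map_natCast, map_natCast, w.frob_teich] at ha
      have h3 : w.teich (p * q) = w.teich ((p - 1 : ℕ) * q) * w.teich q := by
        rw [← w.teich_add, ← add_one_mul, ← Nat.cast_add_one, Nat.sub_add_cancel hp.one_lt.le]
      refine (mul_eq_zero.1 (?_ : (p : Ainf p) * _ = 0)).resolve_left p_ne_zero_Ainf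
      linear_combination ha - n * h3
    · rw [LinearMap.toSpanSingleton_apply, Algebra.smul_def, map_natCast, smul_eq_p_mul, h2]
  · rintro _ ⟨z, rfl⟩
    rw [LinearMap.mem_ker, LinearMap.toSpanSingleton_apply, map_smul, frobSub_apply, w.frob_teich,
      ← w.teich_add, ← add_one_mul, ← Nat.cast_add_one, Nat.sub_add_cancel hp.one_lt.le, sub_self,
      smul_zero]

/-- The equation `φ(y) - [ϖ] ^ q y = a` has a solution divisible by `[ϖ] ^ r` if `a` is divisible
by `[ϖ] ^ (p r)`. -/
theorem exists_frobSub_teich_mul_eq (q r : ℚ≥0) (a : Ainf p) :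
    ∃ y, frobSub w q (w.teich r * y) = w.teich (p * r) * a := by
  simp only [frobSub_apply, map_mul, w.frob_teich]
  -- The equation reads `[ϖ]^(pr) φ(y) - [ϖ]^(q+r) y = [ϖ]^(pr) a`. If `pr ≤ q + r`, cancel
  -- `[ϖ]^(pr)`. Otherwise set `s = pr - (q + r)` and look for `y = [ϖ]^s y'`, which leaves the
  -- contracting equation `y' - [ϖ]^(ps) φ(y') = -a`.
  rcases le_or_gt (p * r) (q + r) with h | h
  · obtain ⟨y, hy⟩ := frobSub_surjective w (q + r - p * r) a
    refine ⟨y, ?_⟩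
    rw [frobSub_apply] at hy
    rw [← hy, mul_sub, ← mul_assoc, ← mul_assoc, ← w.teich_add, ← w.teich_add,
      add_tsub_cancel_of_le h]
  · have hs : 0 < p * r - (q + r) := tsub_pos_of_lt h
    have hp : (0 : ℚ≥0) < p := by exact_mod_cast (Fact.out : p.Prime).pos
    obtain ⟨y, hy⟩ := exists_sub_teich_mul_frob_eq w (mul_pos hp hs) (-a)
    refine ⟨w.teich (p * r - (q + r)) * y, ?_⟩
    have h1 : w.teich (p * r) = w.teich q * w.teich r * w.teich (p * r - (q + r)) := by
      rw [← w.teich_add, ← w.teich_add, add_tsub_cancel_of_le h.le]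
    rw [map_mul, w.frob_teich]
    linear_combination (-w.teich (p * r)) * hy + y * h1

theorem isTorsionFree_of_p_smul {M : Type*} [AddCommGroup M] [Module ℤ_[p] M]
    (h : ∀ x : M, (p : ℤ_[p]) • x = 0 → x = 0) : Module.IsTorsionFree ℤ_[p] M := by
  rw [Submodule.isTorsionFree_iff_torsion_eq_bot, eq_bot_iff]
  rintro x ⟨⟨r, hr⟩, hx⟩
  have h0 : r ≠ 0 := nonZeroDivisors.ne_zero hr
  change r • x = 0 at hx
  rw [PadicInt.unitCoeff_spec h0, mul_smul] at hx
  have h1 := (PadicInt.unitCoeff h0).isUnit.smul_eq_zero.1 hx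
  generalize r.valuation = n at h1
  induction n with
  | zero => simpa using h1
  | succ n ih => exact ih (h _ (by rw [smul_smul, ← pow_succ', h1]))

theorem p_dvd_of_teich_mul_eq {q : ℚ≥0} (hq : 0 < q) {z : ℤ_[p]} {b c : Ainf p}
    (h : algebraMap ℤ_[p] (Ainf p) z = w.teich q * b + p * c) : (p : ℤ_[p]) ∣ z := by
  by_contra hz
  rw [← Ideal.mem_span_singleton, ← PadicInt.maximalIdeal_eq_span_p, IsLocalRing.mem_maximalIdeal,
    mem_nonunits_iff, not_not] at hz
  have h1 := (hz.map (algebraMap ℤ_[p] (Ainf p))).map WittVector.constantCoeff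
  rw [h, map_add, map_mul, map_mul, map_natCast, CharP.cast_eq_zero, zero_mul, add_zero,
    coeff_zero_teich] at h1
  exact w.varpi_not_isUnit hq (isUnit_of_mul_isUnit_left h1)

theorem p_dvd_of_p_dvd_teich_mul {q : ℚ≥0} {b : Ainf p} (h : (p : Ainf p) ∣ w.teich q * b) :
    (p : Ainf p) ∣ b := by
  rw [p_dvd_iff] at h ⊢
  rw [map_mul, coeff_zero_teich] at h
  exact (mul_eq_zero.1 h).resolve_left (w.varpi_ne_zero q)

/-- `[ϖ] ^ q` spans a pure submodule of `A_inf / [ϖ] ^ (q + r)` isomorphic to `ℤ_p`. -/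
theorem tmul_teich_injective (V : Type*) [AddCommGroup V] [Module ℤ_[p] V] (q : ℚ≥0) {r : ℚ≥0}
    (hr : 0 < r) : Function.Injective fun v : V ↦
      v ⊗ₜ[ℤ_[p]] (Ideal.Quotient.mk (Ideal.span {w.teich (q + r)}) (w.teich q)) := by
  let B := Ainf p ⧸ Ideal.span {w.teich (q + r)}
  let e : B := Ideal.Quotient.mk _ (w.teich q)
  let g : ℤ_[p] →ₗ[ℤ_[p]] B := LinearMap.toSpanSingleton ℤ_[p] B e
  have hg' (z : ℤ_[p]) : g z = Ideal.Quotient.mk _ (algebraMap ℤ_[p] (Ainf p) z * w.teich q) := by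
    rw [LinearMap.toSpanSingleton_apply, Algebra.smul_def]
    rfl
  have hmem (z : ℤ_[p]) (a : Ainf p) (h : g z = Ideal.Quotient.mk _ a) :
      ∃ b, a = w.teich q * (algebraMap ℤ_[p] (Ainf p) z - w.teich r * b) := by
    rw [hg', Ideal.Quotient.eq, Ideal.mem_span_singleton] at h
    obtain ⟨b, hb⟩ := h
    refine ⟨b, ?_⟩
    rw [w.teich_add] at hb
    linear_combination -hb
  -- A nonzero `z` in the kernel would be a multiple of `[ϖ]^r`. Powers of `p` cancel from both
  -- sides, since `p` is prime to `[ϖ]^r`, until a unit is a multiple of `[ϖ]^r`, contradicting that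
  -- `ϖ^r` is not a unit.
  have hg : Function.Injective g := by
    rw [injective_iff_map_eq_zero]
    intro z hz
    by_contra h0
    obtain ⟨b, hb⟩ := hmem z 0 hz
    have h1 := (mul_eq_zero.1 hb.symm).resolve_left (teich_ne_zero w q)
    rw [PadicInt.unitCoeff_spec h0, sub_eq_zero, map_mul, map_pow, map_natCast] at h1
    generalize z.valuation = n at h1
    generalize PadicInt.unitCoeff h0 = v at h1
    clear hb
    induction n generalizing b with
    | zero =>
      have h2 := p_dvd_of_teich_mul_eq w hr (z := v) (b := b) (c := 0)
        (by rw [← h1, pow_zero, mul_one, mul_zero, add_zero])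
      exact PadicInt.prime_p.not_isUnit (isUnit_of_dvd_unit h2 v.isUnit)
    | succ n ih =>
      obtain ⟨b, rfl⟩ := p_dvd_of_p_dvd_teich_mul w (q := r) (b := b)
        (h1 ▸ dvd_mul_of_dvd_right (dvd_pow_self _ n.succ_ne_zero) _)
      refine ih b (by
        refine mul_left_cancel₀ p_ne_zero_Ainf ?_
        linear_combination h1)
  -- This is purity: over `ℤ_p` a torsion-free cokernel is flat, so `g` stays injective after
  -- tensoring with any `V`. If `p a` is congruent to `z [ϖ]^q`, then reduction modulo `p` shows
  -- that `p` divides `z`, then the cofactor `b`, and `p` can be cancelled.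
  have : Module.IsTorsionFree ℤ_[p] (B ⧸ LinearMap.range g) := by
    refine isTorsionFree_of_p_smul fun x hx ↦ ?_
    obtain ⟨x, rfl⟩ := Submodule.mkQ_surjective _ x
    obtain ⟨a, rfl⟩ := Ideal.Quotient.mk_surjective x
    rw [← map_smul, Submodule.mkQ_apply, Submodule.Quotient.mk_eq_zero] at hx
    obtain ⟨z, hz⟩ := hx
    obtain ⟨b, hb⟩ := hmem z (p * a) (by rw [hz, ← smul_eq_p_mul]; rfl)
    obtain ⟨c, hc⟩ := p_dvd_of_p_dvd_teich_mul w (hb ▸ dvd_mul_right _ _)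
    obtain ⟨z', rfl⟩ := p_dvd_of_teich_mul_eq w hr (z := z) (b := b) (c := c)
      (by linear_combination hc)
    rw [map_mul, map_natCast] at hb hc
    obtain ⟨b', rfl⟩ := p_dvd_of_p_dvd_teich_mul w (q := r) (b := b)
      ⟨algebraMap ℤ_[p] (Ainf p) z' - c, by linear_combination -hc⟩
    rw [Submodule.mkQ_apply, Submodule.Quotient.mk_eq_zero]
    refine ⟨z', ?_⟩
    rw [hg', Ideal.Quotient.eq, Ideal.mem_span_singleton]
    refine ⟨b', mul_left_cancel₀ p_ne_zero_Ainf ?_⟩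
    rw [w.teich_add]
    linear_combination -hb
  have hinj := LinearMap.lTensor_injective_of_exact_of_flat (LinearMap.range g).mkQ
    (Submodule.mkQ_surjective _) g hg (LinearMap.exact_map_mkQ_range g) V
  have h2 := hinj.comp (TensorProduct.rid ℤ_[p] V).symm.injective
  convert h2 using 2 with v
  simp [g, e, B]

end Ainf

/-! ## The sequence before completion -/

section Generalities

theorem span_triple_pow_le {A : Type*} [CommRing A] (a b c : A) (N : ℕ) :
    Ideal.span {a, b, c} ^ N ≤
      Ideal.span {x | ∃ i j l, i + j + l = N ∧ x = a ^ i * b ^ j * c ^ l} := by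
  induction N with
  | zero =>
    rw [pow_zero, Ideal.one_eq_top, top_le_iff, Ideal.eq_top_iff_one]
    exact Ideal.subset_span ⟨0, 0, 0, rfl, by simp⟩
  | succ N ih =>
    rw [pow_succ]
    refine (Ideal.mul_mono_left ih).trans ?_
    rw [Ideal.span_mul_span', Ideal.span_le]
    rintro _ ⟨_, ⟨i, j, l, rfl, rfl⟩, x, rfl | rfl | rfl, rfl⟩
    · exact Ideal.subset_span ⟨i + 1, j, l, by ring, by dsimp only; ring⟩
    · exact Ideal.subset_span ⟨i, j + 1, l, by ring, by dsimp only; ring⟩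
    · exact Ideal.subset_span ⟨i, j, l + 1, by ring, by dsimp only; ring⟩

theorem mul_mul_mem_span_triple_pow {A : Type*} [CommRing A] (a b c : A) (i j l : ℕ) :
    a ^ i * b ^ j * c ^ l ∈ Ideal.span {a, b, c} ^ (i + j + l) := by
  rw [pow_add, pow_add]
  exact Ideal.mul_mem_mul (Ideal.mul_mem_mul
    (Ideal.pow_mem_pow (Ideal.subset_span (Set.mem_insert _ _)) _)
    (Ideal.pow_mem_pow (Ideal.subset_span (Set.mem_insert_of_mem _ (Set.mem_insert _ _))) _))
    (Ideal.pow_mem_pow (Ideal.subset_span (Set.mem_insert_of_mem _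
      (Set.mem_insert_of_mem _ (Set.mem_singleton _)))) _)

variable {S A B : Type*} [CommRing S] [CommRing A] [CommRing B] [Algebra S A] [Algebra S B]
  {f s : A} {f' s' : B}

theorem fracMap_mk (g : A →ₐ[S] B) (t : B) (hf : g f = f') (hs : g s * t = s')
    (P : Polynomial A) : fracMap g t hf hs (Ideal.Quotient.mk _ P) =
      Ideal.Quotient.mk _ ((P.map (g : A →+* B)).comp (Polynomial.C t * Polynomial.X)) := rfl

variable (f s) in
theorem fracAlg_algebraMap (x : S) : algebraMap S (FracAlg f s) x =
    Ideal.Quotient.mk _ (Polynomial.C (algebraMap S A x)) := rfl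

end Generalities

/-! ### The uncompleted presentation and `φ - 1` on its coefficients -/

variable {p : ℕ} [Fact p.Prime] (R₀ : Type*) [CommRing R₀] [Algebra ℤ_[p] R₀] (u : R₀)
  (w : PowSystem p)

/-- The algebra `(R₀ ⊗ A_inf)[X] / ([ϖ] ^ c X - u)`. -/
abbrev FracT (c : ℚ≥0) : Type _ :=
  FracAlg ((u ⊗ₜ 1 : R₀ ⊗[ℤ_[p]] Ainf p)) ((1 : R₀) ⊗ₜ[ℤ_[p]] w.teich c)

/-- The ideal of `(R₀ ⊗ A_inf)[X] / ([ϖ] ^ c X - u)` generated by `u`, `p` and `[ϖ]`. -/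
abbrev fracTIdeal (c : ℚ≥0) : Ideal (FracT R₀ u w c) := fracIdeal (tensorIdeal R₀ u w) _ _

variable {c c' : ℚ≥0} (hc : c' = p * c)

/-- The map `φ` before completion. -/
def phiT : FracT R₀ u w c →ₐ[R₀] FracT R₀ u w c' :=
  fracMap (frobT R₀) 1 (by simp [frobT]) (by
    rw [mul_one, frobT, Algebra.TensorProduct.map_tmul, map_one, w.frob_teich, hc])

/-- The natural map before completion. -/
def inclT : FracT R₀ u w c →ₐ[R₀] FracT R₀ u w c' :=
  fracMap (AlgHom.id R₀ _) (1 ⊗ₜ w.teich ((p - 1 : ℕ) * c)) (AlgHom.id_apply _) (by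
    rw [AlgHom.id_apply, Algebra.TensorProduct.tmul_mul_tmul, one_mul, ← w.teich_add,
      ← one_add_mul, hc, ← Nat.cast_one_add, Nat.add_sub_cancel' (Fact.out : p.Prime).one_lt.le])

/-- The map `φ - 1` before completion. -/
def deltaT : FracT R₀ u w c →ₗ[R₀] FracT R₀ u w c' :=
  (phiT R₀ u w hc).toLinearMap - (inclT R₀ u w hc).toLinearMap

/-- The map `T ↦ Φ(T) - [ϖ] ^ ((p - 1) k c) T` on coefficients of degree `k`. -/
def coeffDelta (c : ℚ≥0) (k : ℕ) : R₀ ⊗[ℤ_[p]] Ainf p →ₗ[ℤ_[p]] R₀ ⊗[ℤ_[p]] Ainf p :=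
  (frobSub w ((p - 1 : ℕ) * (k * c))).lTensor R₀

theorem coeffDelta_apply (c : ℚ≥0) (k : ℕ) (t : R₀ ⊗[ℤ_[p]] Ainf p) :
    coeffDelta R₀ w c k t =
      frobT R₀ t - t * (1 ⊗ₜ w.teich ((p - 1 : ℕ) * c)) ^ k := by
  induction t with
  | zero => simp
  | add x y hx hy => rw [map_add, hx, hy, map_add]; ring
  | tmul r a =>
    rw [coeffDelta, LinearMap.lTensor_tmul, frobT, Algebra.TensorProduct.map_tmul,
      Algebra.TensorProduct.tmul_pow, Algebra.TensorProduct.tmul_mul_tmul, frobSub_apply,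
      one_pow, mul_one, TensorProduct.tmul_sub, ← w.teich_nat_mul, mul_left_comm, mul_comm a]
    rfl

/-- The map `φ - 1` on polynomials. -/
def polyDelta (c : ℚ≥0) (P : Polynomial (R₀ ⊗[ℤ_[p]] Ainf p)) :
    Polynomial (R₀ ⊗[ℤ_[p]] Ainf p) :=
  (P.map (↑(frobT (p := p) R₀) : R₀ ⊗[ℤ_[p]] Ainf p →+* R₀ ⊗[ℤ_[p]] Ainf p)).comp (Polynomial.C 1 * Polynomial.X) -
    P.comp (Polynomial.C (1 ⊗ₜ w.teich ((p - 1 : ℕ) * c)) * Polynomial.X)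

theorem coeff_polyDelta (P : Polynomial (R₀ ⊗[ℤ_[p]] Ainf p)) (k : ℕ) :
    (polyDelta R₀ w c P).coeff k = coeffDelta R₀ w c k (P.coeff k) := by
  rw [polyDelta, Polynomial.coeff_sub, Polynomial.comp_C_mul_X_coeff,
    Polynomial.comp_C_mul_X_coeff, coeffDelta_apply, one_pow, mul_one, Polynomial.coeff_map]
  rfl

theorem deltaT_mk (P : Polynomial (R₀ ⊗[ℤ_[p]] Ainf p)) :
    deltaT R₀ u w hc (Ideal.Quotient.mk _ P) = Ideal.Quotient.mk _ (polyDelta R₀ w c P) := by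
  rw [deltaT, LinearMap.sub_apply, AlgHom.toLinearMap_apply, AlgHom.toLinearMap_apply, phiT, inclT,
    fracMap_mk, fracMap_mk, polyDelta, map_sub]
  congr 3
  exact Polynomial.map_id

theorem polyDelta_surjective : Function.Surjective (polyDelta R₀ w c) := by
  intro Q
  have h (k : ℕ) : Function.Surjective (coeffDelta R₀ w c k) :=
    LinearMap.lTensor_surjective _ (frobSub_surjective w _)
  choose g hg using h
  refine ⟨∑ k ∈ Q.support, Polynomial.monomial k (g k (Q.coeff k)), Polynomial.ext fun k ↦ ?_⟩
  rw [coeff_polyDelta, Polynomial.finsetSum_coeff]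
  simp only [Polynomial.coeff_monomial, Finset.sum_ite_eq', Polynomial.mem_support_iff]
  split_ifs with h
  · exact hg _ _
  · rw [map_zero, Polynomial.notMem_support_iff.1 h]

/-- Both `φ` and the natural map send `[ϖ]^c X` to `[ϖ]^(pc) X` and fix `u`, so both multiply
through by the same relation. -/
theorem polyDelta_mul (P : Polynomial (R₀ ⊗[ℤ_[p]] Ainf p)) :
    polyDelta R₀ w c ((Polynomial.C (1 ⊗ₜ w.teich c) * Polynomial.X -
      Polynomial.C (u ⊗ₜ 1)) * P) =
    (Polynomial.C (1 ⊗ₜ w.teich (p * c)) * Polynomial.X - Polynomial.C (u ⊗ₜ 1)) *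
      polyDelta R₀ w c P := by
  have h1 : (↑(frobT (p := p) R₀) : R₀ ⊗[ℤ_[p]] Ainf p →+* R₀ ⊗[ℤ_[p]] Ainf p) (1 ⊗ₜ w.teich c) =
      1 ⊗ₜ w.teich (p * c) := by
    change frobT R₀ _ = _
    rw [frobT, Algebra.TensorProduct.map_tmul, map_one, w.frob_teich]
  have h2 : (↑(frobT (p := p) R₀) : R₀ ⊗[ℤ_[p]] Ainf p →+* R₀ ⊗[ℤ_[p]] Ainf p) (u ⊗ₜ 1) =
      u ⊗ₜ 1 := by
    change frobT R₀ _ = _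
    rw [frobT, Algebra.TensorProduct.map_tmul, map_one, AlgHom.id_apply]
  have h3 : (1 ⊗ₜ w.teich c : R₀ ⊗[ℤ_[p]] Ainf p) * (1 ⊗ₜ w.teich ((p - 1 : ℕ) * c)) =
      1 ⊗ₜ w.teich (p * c) := by
    rw [Algebra.TensorProduct.tmul_mul_tmul, one_mul, ← w.teich_add,
      ← one_add_mul, ← Nat.cast_one_add, Nat.add_sub_cancel' (Fact.out : p.Prime).one_lt.le]
  simp only [polyDelta, Polynomial.map_mul, Polynomial.map_sub, Polynomial.map_C, Polynomial.map_X,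
    Polynomial.mul_comp, Polynomial.sub_comp, Polynomial.C_comp, Polynomial.X_comp, h1, h2]
  rw [← mul_assoc (Polynomial.C (1 ⊗ₜ w.teich c)), ← Polynomial.C_mul, h3, Polynomial.C_1]
  ring

theorem mk_monomial_tmul_teich (k : ℕ) (r : R₀) :
    (Ideal.Quotient.mk _ (Polynomial.monomial k (r ⊗ₜ w.teich (k * c))) : FracT R₀ u w c) =
      algebraMap R₀ (FracT R₀ u w c) (r * u ^ k) := by
  have h1 : (Ideal.Quotient.mk _ (Polynomial.C (1 ⊗ₜ w.teich c) * Polynomial.X) :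
      FracT R₀ u w c) = Ideal.Quotient.mk _ (Polynomial.C (u ⊗ₜ 1)) :=
    Ideal.Quotient.eq.2 (Ideal.subset_span rfl)
  have h2 : Polynomial.monomial k (r ⊗ₜ w.teich (k * c) : R₀ ⊗[ℤ_[p]] Ainf p) =
      Polynomial.C (r ⊗ₜ 1) * (Polynomial.C (1 ⊗ₜ w.teich c) * Polynomial.X) ^ k := by
    rw [mul_pow, ← Polynomial.C_pow, ← mul_assoc, ← Polynomial.C_mul,
      Algebra.TensorProduct.tmul_pow, Algebra.TensorProduct.tmul_mul_tmul, one_pow, mul_one,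
      one_mul, ← w.teich_nat_mul, Polynomial.C_mul_X_pow_eq_monomial]
  rw [h2, map_mul, map_pow, h1, ← map_pow, ← map_mul, ← Polynomial.C_pow, ← Polynomial.C_mul,
    Algebra.TensorProduct.tmul_pow, Algebra.TensorProduct.tmul_mul_tmul, one_pow, mul_one]
  rfl

/-- The kernel of `φ - 1` before completion is `R₀`. -/
theorem exists_algebraMap_eq_of_deltaT_eq_zero {x : FracT R₀ u w c}
    (hx : deltaT R₀ u w hc x = 0) : ∃ r : R₀, algebraMap R₀ _ r = x := by
  subst hc
  obtain ⟨P, rfl⟩ := Ideal.Quotient.mk_surjective x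
  rw [deltaT_mk, Ideal.Quotient.eq_zero_iff_mem, Ideal.mem_span_singleton] at hx
  obtain ⟨H', hH'⟩ := hx
  -- Lifting the cofactor through `φ - 1` allows `P` to be changed by a multiple of the relation
  -- into a polynomial `Q` killed by `φ - 1` exactly, not merely modulo the relation.
  obtain ⟨H, rfl⟩ := polyDelta_surjective R₀ w (c := c) H'
  rw [← polyDelta_mul] at hH'
  obtain ⟨Q, hQ⟩ : ∃ Q, Q = P - (Polynomial.C (1 ⊗ₜ w.teich c) * Polynomial.X -
    Polynomial.C (u ⊗ₜ 1)) * H := ⟨_, rfl⟩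
  have hPQ : (Ideal.Quotient.mk _ P : FracT R₀ u w c) = Ideal.Quotient.mk _ Q := by
    rw [Ideal.Quotient.eq, Ideal.mem_span_singleton, hQ, sub_sub_cancel]
    exact dvd_mul_right _ _
  have hcoeff (k : ℕ) : ∃ r : R₀, Q.coeff k = r ⊗ₜ w.teich (k * c) := by
    have h0 : coeffDelta R₀ w c k (Q.coeff k) = 0 := by
      rw [hQ, Polynomial.coeff_sub, map_sub, ← coeff_polyDelta, ← coeff_polyDelta, hH', sub_self]
    obtain ⟨t, ht⟩ := (lTensor_exact R₀ (exact_toSpanSingleton_frobSub w (k * c))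
      (frobSub_surjective w _) _).1 h0
    obtain ⟨r, rfl⟩ := (TensorProduct.rid ℤ_[p] R₀).symm.surjective t
    exact ⟨r, by simp [← ht]⟩
  choose r hr using hcoeff
  refine ⟨∑ k ∈ Q.support, r k * u ^ k, ?_⟩
  rw [hPQ, map_sum]
  conv_rhs => rw [Q.as_sum_support, map_sum]
  exact Finset.sum_congr rfl fun k _ ↦ by rw [hr, mk_monomial_tmul_teich]

theorem fracTIdeal_eq (c : ℚ≥0) : fracTIdeal R₀ u w c = Ideal.span
    {algebraMap (R₀ ⊗[ℤ_[p]] Ainf p) (FracT R₀ u w c) (u ⊗ₜ 1),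
      algebraMap (R₀ ⊗[ℤ_[p]] Ainf p) (FracT R₀ u w c) (1 ⊗ₜ p),
      algebraMap (R₀ ⊗[ℤ_[p]] Ainf p) (FracT R₀ u w c) (1 ⊗ₜ w.teich 1)} := by
  rw [fracTIdeal, fracIdeal, tensorIdeal, Ideal.map_span, Set.image_insert_eq,
    Set.image_insert_eq, Set.image_singleton]

theorem deltaT_mk_monomial (k : ℕ) (r : R₀) (a : Ainf p) :
    deltaT R₀ u w hc (Ideal.Quotient.mk _ (Polynomial.monomial k (r ⊗ₜ a))) =
      Ideal.Quotient.mk _ (Polynomial.monomial k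
        (r ⊗ₜ frobSub w ((p - 1 : ℕ) * (k * c)) a)) := by
  rw [deltaT_mk]
  congr 1
  ext j
  rw [coeff_polyDelta, Polynomial.coeff_monomial, Polynomial.coeff_monomial]
  split_ifs with h
  · subst h; rfl
  · rw [map_zero]

theorem mk_monomial_mul_algebraMap (i j l k : ℕ) (r : R₀) (a : Ainf p) :
    (Ideal.Quotient.mk _ (Polynomial.monomial k (r ⊗ₜ a)) : FracT R₀ u w c) *
      (algebraMap (R₀ ⊗[ℤ_[p]] Ainf p) (FracT R₀ u w c) (u ⊗ₜ 1) ^ i *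
        algebraMap (R₀ ⊗[ℤ_[p]] Ainf p) (FracT R₀ u w c) (1 ⊗ₜ p) ^ j *
        algebraMap (R₀ ⊗[ℤ_[p]] Ainf p) (FracT R₀ u w c) (1 ⊗ₜ w.teich 1) ^ l) =
      Ideal.Quotient.mk _ (Polynomial.monomial k
        ((u ^ i * r) ⊗ₜ (p ^ j * (w.teich l * a)))) := by
  rw [← map_pow, ← map_pow, ← map_pow, ← map_mul, ← map_mul]
  change Ideal.Quotient.mk _ _ * Ideal.Quotient.mk _ (Polynomial.C _) = _
  rw [← map_mul, Polynomial.monomial_mul_C]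
  congr 2
  simp only [Algebra.TensorProduct.tmul_pow, Algebra.TensorProduct.tmul_mul_tmul, one_pow, mul_one,
    one_mul, ← w.teich_nat_mul]
  congr 1 <;> ring

/-- `φ - 1` is surjective and open before completion. -/
theorem exists_mem_pow_deltaT_eq (n : ℕ) {y : FracT R₀ u w c'}
    (hy : y ∈ fracTIdeal R₀ u w c' ^ (p * n)) :
    ∃ x ∈ fracTIdeal R₀ u w c ^ n, deltaT R₀ u w hc x = y := by
  have hp : p.Prime := Fact.out
  let K : Submodule R₀ (FracT R₀ u w c') :=
    ((fracTIdeal R₀ u w c ^ n).restrictScalars R₀).map (deltaT R₀ u w hc)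
  change y ∈ K
  rw [fracTIdeal_eq] at hy
  replace hy := span_triple_pow_le _ _ _ _ hy
  -- `K` is only an `R₀`-submodule, so stability under multiplication by arbitrary `z` is built into
  -- the induction over the ideal.
  suffices ∀ z, z * y ∈ K by simpa using this 1
  induction hy using Submodule.span_induction with
  | zero => simp
  | add x y _ _ hx hy => exact fun z ↦ by rw [mul_add]; exact K.add_mem (hx z) (hy z)
  | smul r x _ hx => exact fun z ↦ by rw [smul_eq_mul, ← mul_assoc]; exact hx _
  | mem x hx =>
    obtain ⟨i, j, l, hijl, rfl⟩ := hx
    intro z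
    obtain ⟨P, rfl⟩ := Ideal.Quotient.mk_surjective z
    induction P using Polynomial.induction_on' with
    | add P Q hP hQ => rw [map_add, add_mul]; exact K.add_mem hP hQ
    | monomial k t =>
      induction t with
      | zero => simp
      | add s t hs ht => rw [map_add, map_add, add_mul]; exact K.add_mem hs ht
      | tmul r a =>
        rw [mk_monomial_mul_algebraMap]
        -- `u^i` and `p^j` commute with the operator, while `[ϖ]^l` costs a factor `p` in the
        -- exponent: the solution is divisible by `[ϖ]^(l/p)`. This is why the `pn`-th power is
        -- needed.
        obtain ⟨b, hb⟩ := exists_frobSub_teich_mul_eq w ((p - 1 : ℕ) * (k * c)) (l / p) a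
        rw [mul_div_cancel₀ _ (by exact_mod_cast hp.ne_zero)] at hb
        refine ⟨Ideal.Quotient.mk _ (Polynomial.monomial k
          ((u ^ i * r) ⊗ₜ (p ^ j * (w.teich (l / p) * b)))), ?_, ?_⟩
        · have h1 : ((l / p : ℕ) : ℚ≥0) ≤ l / p := Nat.cast_div_le
          -- The left exponent is the rational `l/p`; only its integral part counts towards the
          -- power of the ideal.
          have h2 : w.teich (l / p) = w.teich (l / p : ℕ) * w.teich (l / p - (l / p : ℕ)) := by
            rw [← w.teich_add, add_tsub_cancel_of_le h1]
          rw [h2, mul_assoc, ← mk_monomial_mul_algebraMap]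
          refine Ideal.mul_mem_left _ _ (Ideal.pow_le_pow_right (n := i + j + l / p) ?_ ?_)
          · have h3 : n ≤ (i + j + l) / p := by
              rw [hijl, Nat.mul_div_cancel_left _ hp.pos]
            refine h3.trans ?_
            rw [Nat.div_le_iff_le_mul_add_pred hp.pos]
            have h4 := Nat.div_add_mod l p
            have h5 := Nat.mod_lt l hp.pos
            have h6 : i + j ≤ p * (i + j) := Nat.le_mul_of_pos_left _ hp.pos
            rw [mul_add]
            omega
          · rw [fracTIdeal_eq]
            exact mul_mul_mem_span_triple_pow _ _ _ i j (l / p)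
        · have h1 : frobSub w ((p - 1 : ℕ) * (k * c)) (p ^ j * (w.teich (l / p) * b)) =
              p ^ j * (w.teich l * a) := by
            rw [← hb, frobSub_apply, frobSub_apply, map_mul, map_pow, map_natCast]
            ring
          rw [deltaT_mk_monomial, h1]

/-! ### The topology induced on `R₀` -/

section Functional

variable (c) (K : ℕ)

/-- The map `r ⊗ a ↦ u ^ k r ⊗ [ϖ] ^ (c (K - k)) a` from `R₀ ⊗ A_inf` to
`R₀ / u ^ K ⊗ A_inf / [ϖ] ^ (c K + 1)`. -/
def detectCoeff (k : ℕ) : R₀ ⊗[ℤ_[p]] Ainf p →ₗ[ℤ_[p]]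
    (R₀ ⧸ Ideal.span {u} ^ K) ⊗[ℤ_[p]] (Ainf p ⧸ Ideal.span {w.teich (c * K + 1)}) :=
  TensorProduct.map
    ((Ideal.Quotient.mkₐ ℤ_[p] _).toLinearMap ∘ₗ LinearMap.mulLeft ℤ_[p] (u ^ k))
    ((Ideal.Quotient.mkₐ ℤ_[p] _).toLinearMap ∘ₗ
      LinearMap.mulLeft ℤ_[p] (w.teich (c * (K - k : ℕ))))

theorem detectCoeff_tmul (k : ℕ) (r : R₀) (a : Ainf p) :
    detectCoeff R₀ u w c K k (r ⊗ₜ a) = (Ideal.Quotient.mk _ (u ^ k * r)) ⊗ₜ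
      (Ideal.Quotient.mk _ (w.teich (c * (K - k : ℕ)) * a)) := rfl

/-- The map `X ^ k (r ⊗ a) ↦ u ^ k r ⊗ [ϖ] ^ (c (K - k)) a`: it vanishes on multiples of
`[ϖ] ^ c X - u` and detects `r` modulo `u ^ K`. -/
def detect : Polynomial (R₀ ⊗[ℤ_[p]] Ainf p) →ₗ[ℤ_[p]]
    (R₀ ⧸ Ideal.span {u} ^ K) ⊗[ℤ_[p]] (Ainf p ⧸ Ideal.span {w.teich (c * K + 1)}) :=
  Polynomial.lsum (detectCoeff R₀ u w c K)

theorem detect_monomial (k : ℕ) (t : R₀ ⊗[ℤ_[p]] Ainf p) :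
    detect R₀ u w c K (Polynomial.monomial k t) = detectCoeff R₀ u w c K k t := by
  rw [detect, Polynomial.lsum_apply]
  exact Polynomial.sum_monomial_index _ _ (map_zero _)

theorem mk_pow_mul_eq_zero {k : ℕ} (hk : K ≤ k) (r : R₀) :
    (Ideal.Quotient.mk (Ideal.span {u} ^ K) (u ^ k * r)) = 0 := by
  rw [Ideal.Quotient.eq_zero_iff_mem]
  exact Ideal.mul_mem_right _ _
    (Ideal.pow_le_pow_right hk (Ideal.pow_mem_pow (Ideal.mem_span_singleton_self _) _))

/-- `detect` is the substitution `X = u/[ϖ]^c` multiplied by `[ϖ]^(cK)`, which clears denominators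
in degrees up to `K`; in degrees at least `K` the factor `u^k` is already zero in the target. -/
theorem detect_mul (P : Polynomial (R₀ ⊗[ℤ_[p]] Ainf p)) :
    detect R₀ u w c K ((Polynomial.C (1 ⊗ₜ w.teich c) * Polynomial.X -
      Polynomial.C (u ⊗ₜ 1)) * P) = 0 := by
  induction P using Polynomial.induction_on' with
  | add P Q hP hQ => rw [mul_add, map_add, hP, hQ, add_zero]
  | monomial k t =>
    rw [sub_mul, Polynomial.C_mul_X_eq_monomial, Polynomial.monomial_mul_monomial,
      Polynomial.C_mul_monomial, map_sub, detect_monomial, detect_monomial, sub_eq_zero]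
    induction t with
    | zero => simp
    | add s t hs ht => rw [mul_add, mul_add, map_add, map_add, hs, ht]
    | tmul r a =>
      rw [Algebra.TensorProduct.tmul_mul_tmul, Algebra.TensorProduct.tmul_mul_tmul, one_mul,
        one_mul, detectCoeff_tmul, detectCoeff_tmul, add_comm 1 k, ← mul_assoc (u ^ k), ← pow_succ]
      -- The truncated subtraction `K - k` is a true difference only in the first case; in the
      -- second both sides vanish.
      rcases lt_or_ge k K with h | h
      · congr 2
        rw [← mul_assoc, ← w.teich_add, ← mul_add_one, ← Nat.cast_add_one]
        congr 4
        omega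
      · rw [mk_pow_mul_eq_zero R₀ u K (by omega), TensorProduct.zero_tmul, TensorProduct.zero_tmul]

theorem detectCoeff_eq_zero_of_mem_pow {M L : ℕ} (hM : (p : R₀) ^ M ∈ Ideal.span {u} ^ K)
    (hL : c * K + 1 ≤ L) {x : R₀ ⊗[ℤ_[p]] Ainf p}
    (hx : x ∈ tensorIdeal R₀ u w ^ (K + M + L)) (k : ℕ) : detectCoeff R₀ u w c K k x = 0 := by
  rw [tensorIdeal] at hx
  replace hx := span_triple_pow_le _ _ _ _ hx
  suffices ∀ z, detectCoeff R₀ u w c K k (z * x) = 0 by simpa using this 1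
  induction hx using Submodule.span_induction with
  | zero => simp
  | add x y _ _ hx hy => exact fun z ↦ by rw [mul_add, map_add, hx, hy, add_zero]
  | smul r x _ hx => exact fun z ↦ by rw [smul_eq_mul, ← mul_assoc]; exact hx _
  | mem x hx =>
    obtain ⟨i, j, l, hijl, rfl⟩ := hx
    intro z
    induction z with
    | zero => simp
    | add s t hs ht => rw [add_mul, map_add, hs, ht, add_zero]
    | tmul r a =>
      have hp : ((1 : R₀) ⊗ₜ[ℤ_[p]] (p : Ainf p)) ^ j =
          ((p : R₀) ^ j) ⊗ₜ[ℤ_[p]] (1 : Ainf p) := by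
        have h1 : (1 : R₀) ⊗ₜ[ℤ_[p]] (p : Ainf p) = (p : R₀ ⊗[ℤ_[p]] Ainf p) :=
          map_natCast (Algebra.TensorProduct.includeRight (R := ℤ_[p]) (A := R₀) (B := Ainf p)) p
        have h2 : (p : R₀) ⊗ₜ[ℤ_[p]] (1 : Ainf p) = (p : R₀ ⊗[ℤ_[p]] Ainf p) :=
          map_natCast (Algebra.TensorProduct.includeLeft (R := ℤ_[p]) (S := ℤ_[p]) (A := R₀)
            (B := Ainf p)) p
        rw [h1, ← h2, Algebra.TensorProduct.tmul_pow, one_pow]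
      rw [hp, Algebra.TensorProduct.tmul_pow, Algebra.TensorProduct.tmul_pow,
        Algebra.TensorProduct.tmul_mul_tmul, Algebra.TensorProduct.tmul_mul_tmul,
        Algebra.TensorProduct.tmul_mul_tmul, detectCoeff_tmul, ← w.teich_nat_mul]
      simp only [one_pow, mul_one, one_mul]
      -- Each alternative kills the generator in the target: `u^K = 0`, `p^M` lies in `(u)^K`, and
      -- `[ϖ]^L` is divisible by `[ϖ]^(cK+1)`.
      have hcases : K ≤ i ∨ M ≤ j ∨ L ≤ l := by omega
      rcases hcases with h | h | h
      · rw [show u ^ k * (r * (u ^ i * (p : R₀) ^ j)) = u ^ i * (u ^ k * r * (p : R₀) ^ j) by ring,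
          mk_pow_mul_eq_zero R₀ u K h, TensorProduct.zero_tmul]
      · rw [Ideal.Quotient.eq_zero_iff_mem.2, TensorProduct.zero_tmul]
        rw [← Nat.add_sub_cancel' h, pow_add]
        exact Ideal.mul_mem_left _ _ (Ideal.mul_mem_left _ _
          (Ideal.mul_mem_left _ _ (Ideal.mul_mem_right _ _ hM)))
      · rw [(Ideal.Quotient.eq_zero_iff_mem
          (a := w.teich (c * (K - k : ℕ)) * (a * w.teich l))).2, TensorProduct.tmul_zero]
        have h1 : c * K + 1 ≤ l := hL.trans (by exact_mod_cast h)
        have h2 : w.teich l = w.teich (c * K + 1) * w.teich (l - (c * K + 1)) := by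
          rw [← w.teich_add, add_tsub_cancel_of_le h1]
        rw [h2]
        exact Ideal.mul_mem_left _ _ (Ideal.mul_mem_left _ _
          (Ideal.mul_mem_right _ _ (Ideal.mem_span_singleton_self _)))

/-- The topology of `(R₀ ⊗ A_inf)[X] / ([ϖ] ^ c X - u)` induces the `u`-adic topology on `R₀`. -/
theorem exists_forall_mem_pow_of_algebraMap_mem
    (hM : ∃ M, (p : R₀) ^ M ∈ Ideal.span {u} ^ K) :
    ∃ N, ∀ r : R₀, algebraMap R₀ (FracT R₀ u w c) r ∈ fracTIdeal R₀ u w c ^ N →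
      r ∈ Ideal.span {u} ^ K := by
  obtain ⟨M, hM⟩ := hM
  obtain ⟨L, hL⟩ := exists_nat_ge (c * K + 1)
  refine ⟨K + M + L, fun r hr ↦ ?_⟩
  rw [fracTIdeal, fracIdeal, ← Ideal.map_pow, fracAlg_algebraMap] at hr
  have h1 : algebraMap (R₀ ⊗[ℤ_[p]] Ainf p) (FracT R₀ u w c) =
    (Ideal.Quotient.mk _).comp Polynomial.C := rfl
  rw [h1, ← Ideal.map_map, Ideal.mem_map_iff_of_surjective _ Ideal.Quotient.mk_surjective] at hr
  obtain ⟨P, hP, hPr⟩ := hr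
  rw [Ideal.Quotient.eq, Ideal.mem_span_singleton] at hPr
  obtain ⟨H, hH⟩ := hPr
  have h2 : detect R₀ u w c K P = 0 := by
    rw [detect, Polynomial.lsum_apply, Polynomial.sum_def]
    refine Finset.sum_eq_zero fun k _ ↦ ?_
    exact detectCoeff_eq_zero_of_mem_pow R₀ u w c K hM hL (Ideal.mem_map_C_iff.1 hP k) k
  have h3 := congrArg (detect R₀ u w c K) hH
  rw [map_sub, h2, detect_mul, zero_sub, neg_eq_zero, ← Polynomial.monomial_zero_left,
    detect_monomial] at h3
  change detectCoeff R₀ u w c K 0 (r ⊗ₜ 1) = 0 at h3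
  rw [detectCoeff_tmul, pow_zero, one_mul, mul_one, Nat.sub_zero] at h3
  rw [← Ideal.Quotient.eq_zero_iff_mem]
  -- A constant `r` is sent to `r ⊗ [ϖ]^(cK)`, so purity recovers `r` modulo `u^K`.
  exact tmul_teich_injective w (R₀ ⧸ Ideal.span {u} ^ K) (c * K) one_pos
    (h3.trans (TensorProduct.zero_tmul _ _).symm)

end Functional

/-! ## Exactness and adic completion -/

section Completion

open AdicCompletion (evalₐ evalₐ_mk evalₐ_liftAlgHom ext_evalₐ AdicCauchySequence)

variable {S A B : Type*} [CommRing S] [CommRing A] [CommRing B] [Algebra S A] [Algebra S B]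
  (I : Ideal A) (J : Ideal B)

theorem evalₐ_algebraMap (n : ℕ) (a : A) :
    evalₐ I n (algebraMap A (AdicCompletion I A) a) = Ideal.Quotient.mk _ a :=
  (evalₐ I n).commutes a

theorem algebraMap_adicCompletion (r : S) : algebraMap S (AdicCompletion I A) r =
    algebraMap A (AdicCompletion I A) (algebraMap S A r) := rfl

variable {I} in
theorem exists_evalₐ_eq (f : ℕ → A) (hf : ∀ n, f (n + 1) - f n ∈ I ^ n) :
    ∃ x : AdicCompletion I A, ∀ n, evalₐ I n x = Ideal.Quotient.mk _ (f n) :=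
  ⟨AdicCompletion.mk I A (AdicCauchySequence.mk I A f fun n ↦ by
    rw [SModEq.comm, SModEq.sub_mem]
    simpa using hf n), fun n ↦ evalₐ_mk _ _ _⟩

variable {I} in
theorem evalₐ_eq_mk_of_le {m n : ℕ} (h : m ≤ n) {x : AdicCompletion I A} {a : A}
    (hx : evalₐ I n x = Ideal.Quotient.mk _ a) : evalₐ I m x = Ideal.Quotient.mk _ a := by
  induction x using AdicCompletion.induction_on with
  | _ y =>
    rw [evalₐ_mk] at hx ⊢
    rw [← AdicCompletion.Ideal.mk_eq_mk I h y]
    rw [Ideal.Quotient.eq] at hx ⊢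
    exact Ideal.pow_le_pow_right h hx

variable {I J}

theorem evalₐ_adicMap (g : A →ₐ[S] B) (h : I.map g ≤ J) (n : ℕ) (x : AdicCompletion I A) :
    evalₐ J n (adicMap I J g h x) = quotPowMap I J g h n (evalₐ I n x) :=
  evalₐ_liftAlgHom J _ (quotPowMap_compat I J g h) n x

theorem evalₐ_adicMap_eq_mk (g : A →ₐ[S] B) (h : I.map g ≤ J) {n : ℕ} {x : AdicCompletion I A}
    {a : A} (hx : evalₐ I n x = Ideal.Quotient.mk _ a) :
    evalₐ J n (adicMap I J g h x) = Ideal.Quotient.mk _ (g a) := by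
  rw [evalₐ_adicMap, hx, quotPowMap_mk]

/-- A map `A → B` with dense image along which the `J`-adic topology induces the `I`-adic topology
becomes an isomorphism on completions. -/
theorem adicMap_bijective (g : A →ₐ[S] B) (h : I.map g ≤ J)
    (hdense : ∀ n b, ∃ a, b - g a ∈ J ^ n) (hinj : ∀ n a, g a ∈ J ^ n → a ∈ I ^ n) :
    Function.Bijective (adicMap I J g h) := by
  constructor
  · rw [injective_iff_map_eq_zero]
    intro x hx
    refine ext_evalₐ fun n ↦ ?_
    obtain ⟨a, ha⟩ := Ideal.Quotient.mk_surjective (evalₐ I n x)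
    have h1 := evalₐ_adicMap_eq_mk g h ha.symm
    rw [hx, map_zero, eq_comm, Ideal.Quotient.eq_zero_iff_mem] at h1
    rw [← ha, map_zero, Ideal.Quotient.eq_zero_iff_mem]
    exact hinj n a h1
  · intro y
    have h1 (n : ℕ) : ∃ a, evalₐ J n y = Ideal.Quotient.mk _ (g a) := by
      obtain ⟨b, hb⟩ := Ideal.Quotient.mk_surjective (evalₐ J n y)
      obtain ⟨a, ha⟩ := hdense n b
      exact ⟨a, by rw [← hb, Ideal.Quotient.eq]; exact ha⟩
    choose a ha using h1
    obtain ⟨x, hx⟩ := exists_evalₐ_eq (I := I) a fun n ↦ hinj n _ (by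
      rw [map_sub, ← Ideal.Quotient.eq, ← ha n]
      exact (evalₐ_eq_mk_of_le n.le_succ (ha (n + 1))).symm)
    exact ⟨x, ext_evalₐ fun n ↦ by rw [evalₐ_adicMap_eq_mk g h (hx n), ha]⟩

theorem adicMap_comm {C D : Type*} [CommRing C] [CommRing D] [Algebra S C] [Algebra S D]
    {K : Ideal C} {L : Ideal D} (g₁ : A →ₐ[S] B) (h₁ : I.map g₁ ≤ J) (g₂ : B →ₐ[S] D)
    (h₂ : J.map g₂ ≤ L) (g₃ : A →ₐ[S] C) (h₃ : I.map g₃ ≤ K) (g₄ : C →ₐ[S] D) (h₄ : K.map g₄ ≤ L)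
    (hcomm : ∀ a, g₂ (g₁ a) = g₄ (g₃ a)) (x : AdicCompletion I A) :
    adicMap J L g₂ h₂ (adicMap I J g₁ h₁ x) = adicMap K L g₄ h₄ (adicMap I K g₃ h₃ x) := by
  refine ext_evalₐ fun n ↦ ?_
  obtain ⟨a, ha⟩ := Ideal.Quotient.mk_surjective (evalₐ I n x)
  rw [evalₐ_adicMap_eq_mk g₂ h₂ (evalₐ_adicMap_eq_mk g₁ h₁ ha.symm),
    evalₐ_adicMap_eq_mk g₄ h₄ (evalₐ_adicMap_eq_mk g₃ h₃ ha.symm), hcomm]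

variable (g₁ g₂ : A →ₐ[S] B) (h₁ : I.map g₁ ≤ J) (h₂ : I.map g₂ ≤ J)

/-- Openness lets the successive differences of approximations to `y` be lifted to smaller and
smaller elements, whose sums converge to a preimage. -/
theorem adicMap_sub_surjective {e : ℕ} (he : 0 < e)
    (hsurj : ∀ n, ∀ y ∈ J ^ (e * n), ∃ x ∈ I ^ n, g₁ x - g₂ x = y) (y : AdicCompletion J B) :
    ∃ x, adicMap I J g₁ h₁ x - adicMap I J g₂ h₂ x = y := by
  choose b hb using fun n ↦ Ideal.Quotient.mk_surjective (evalₐ J (e * n) y)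
  choose! z hz hz' using hsurj
  have hmem (n : ℕ) : b (n + 1) - b n ∈ J ^ (e * n) := by
    rw [← Ideal.Quotient.eq, hb n]
    exact (evalₐ_eq_mk_of_le (Nat.mul_le_mul_left _ n.le_succ) (hb (n + 1)).symm).symm
  let a : ℕ → A := fun n ↦ Nat.rec (z 0 (b 0)) (fun n a ↦ a + z n (b (n + 1) - b n)) n
  have hs (n : ℕ) : a (n + 1) = a n + z n (b (n + 1) - b n) := rfl
  have ha (n : ℕ) : g₁ (a n) - g₂ (a n) = b n := by
    induction n with
    | zero => exact hz' 0 _ (by simp)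
    | succ n ih =>
      have := hz' n _ (hmem n)
      rw [hs, map_add, map_add]
      linear_combination ih + this
  obtain ⟨x, hx⟩ := exists_evalₐ_eq (I := I) a fun n ↦ by
    rw [hs, add_sub_cancel_left]
    exact hz n _ (hmem n)
  refine ⟨x, ext_evalₐ fun n ↦ ?_⟩
  rw [map_sub, evalₐ_adicMap_eq_mk g₁ h₁ (hx n), evalₐ_adicMap_eq_mk g₂ h₂ (hx n), ← map_sub, ha]
  exact (evalₐ_eq_mk_of_le (Nat.le_mul_of_pos_left n he) (hb n).symm).symm

variable (K : Ideal S)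

theorem algebraMap_adicCompletion_injective [IsHausdorff K S]
    (htop : ∀ k, ∃ N, ∀ r, algebraMap S A r ∈ I ^ N → r ∈ K ^ k) :
    Function.Injective (algebraMap S (AdicCompletion I A)) := by
  rw [injective_iff_map_eq_zero]
  intro r hr
  refine IsHausdorff.haus (I := K) inferInstance r fun k ↦ ?_
  obtain ⟨N, hN⟩ := htop k
  rw [SModEq.zero, smul_eq_mul, Ideal.mul_top]
  refine hN r ?_
  rw [← Ideal.Quotient.eq_zero_iff_mem, ← evalₐ_algebraMap, ← algebraMap_adicCompletion, hr,
    map_zero]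

-- Openness corrects approximations of `x` to exact kernel elements, hence elements of `S`. They are
-- Cauchy in `S` because the induced topology is `K`-adic, and the limit is the required element.
include h₁ h₂ in
theorem exists_algebraMap_eq_of_adicMap_eq [IsPrecomplete K S] {e : ℕ} (he : 0 < e)
    (hsurj : ∀ n, ∀ y ∈ J ^ (e * n), ∃ x ∈ I ^ n, g₁ x - g₂ x = y)
    (hker : ∀ x, g₁ x - g₂ x = 0 → ∃ r, algebraMap S A r = x)
    (htop : ∀ k, ∃ N, ∀ r, algebraMap S A r ∈ I ^ N → r ∈ K ^ k)
    (hK : K.map (algebraMap S A) ≤ I) {x : AdicCompletion I A}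
    (hx : adicMap I J g₁ h₁ x - adicMap I J g₂ h₂ x = 0) :
    ∃ r, algebraMap S (AdicCompletion I A) r = x := by
  have happrox (n : ℕ) : ∃ r, evalₐ I n x = Ideal.Quotient.mk _ (algebraMap S A r) := by
    obtain ⟨a, ha⟩ := Ideal.Quotient.mk_surjective (evalₐ I (e * n) x)
    have h3 := congrArg (evalₐ J (e * n)) hx
    rw [map_sub, evalₐ_adicMap_eq_mk g₁ h₁ ha.symm, evalₐ_adicMap_eq_mk g₂ h₂ ha.symm, ← map_sub,
      map_zero, Ideal.Quotient.eq_zero_iff_mem] at h3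
    obtain ⟨z, hz, hz'⟩ := hsurj n _ h3
    obtain ⟨r, hr⟩ := hker (a - z) (by rw [map_sub, map_sub]; linear_combination -hz')
    refine ⟨r, ?_⟩
    rw [evalₐ_eq_mk_of_le (Nat.le_mul_of_pos_left n he) ha.symm, Ideal.Quotient.eq, hr,
      sub_sub_cancel]
    exact hz
  choose r hr using happrox
  choose N hN using htop
  -- A monotone sequence dominating both `N k` and `k`: the first bound makes the chosen subsequence
  -- Cauchy in `S`, the second makes it converge to `x`.
  let M : ℕ → ℕ := fun k ↦ ∑ i ∈ Finset.range (k + 1), (N i + 1)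
  have hNM (k : ℕ) : N k ≤ M k :=
    (Nat.le_succ _).trans (Finset.single_le_sum (f := fun i ↦ N i + 1) (fun _ _ ↦ Nat.zero_le _)
      (Finset.self_mem_range_succ k))
  have hM (k : ℕ) : k ≤ M k := by
    calc k ≤ ∑ i ∈ Finset.range (k + 1), 1 := by simp
      _ ≤ M k := Finset.sum_le_sum fun _ _ ↦ Nat.le_add_left _ _
  have hMmono : Monotone M := fun a b hab ↦
    Finset.sum_le_sum_of_subset (Finset.range_mono (Nat.succ_le_succ hab))
  obtain ⟨L, hL⟩ := IsPrecomplete.prec (I := K) inferInstance (f := fun k ↦ r (M k)) (by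
    intro m n hmn
    rw [SModEq.sub_mem, smul_eq_mul, Ideal.mul_top]
    refine hN m _ (Ideal.pow_le_pow_right (hNM m) ?_)
    rw [map_sub, ← Ideal.Quotient.eq, ← hr]
    exact evalₐ_eq_mk_of_le (hMmono hmn) (hr (M n)))
  refine ⟨L, ext_evalₐ fun n ↦ ?_⟩
  rw [algebraMap_adicCompletion, evalₐ_algebraMap, evalₐ_eq_mk_of_le (hM n) (hr (M n)), eq_comm,
    Ideal.Quotient.eq, ← map_sub]
  have h4 := hL n
  rw [SModEq.sub_mem, smul_eq_mul, Ideal.mul_top] at h4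
  refine Ideal.pow_right_mono hK n ?_
  rw [← Ideal.map_pow]
  exact Ideal.mem_map_of_mem _ h4

end Completion

/-! ### Localization before and after completing the base -/

section Frac

variable {S A B C D : Type*} [CommRing S] [CommRing A] [CommRing B] [CommRing C] [CommRing D]
  [Algebra S A] [Algebra S B] [Algebra S C] [Algebra S D]

theorem fracMap_fracMap {f s : A} {f₁ s₁ : B} {f₂ s₂ : C} {f₃ s₃ : D} (g₁ : A →ₐ[S] B) (t₁ : B)
    (hf₁ : g₁ f = f₁) (hs₁ : g₁ s * t₁ = s₁) (g₂ : B →ₐ[S] D) (t₂ : D) (hf₂ : g₂ f₁ = f₃)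
    (hs₂ : g₂ s₁ * t₂ = s₃) (g₃ : A →ₐ[S] C) (t₃ : C) (hf₃ : g₃ f = f₂) (hs₃ : g₃ s * t₃ = s₂)
    (g₄ : C →ₐ[S] D) (t₄ : D) (hf₄ : g₄ f₂ = f₃) (hs₄ : g₄ s₂ * t₄ = s₃)
    (hcomm : ∀ a, g₂ (g₁ a) = g₄ (g₃ a)) (ht : g₂ t₁ * t₂ = g₄ t₃ * t₄) (x : FracAlg f s) :
    fracMap g₂ t₂ hf₂ hs₂ (fracMap g₁ t₁ hf₁ hs₁ x) =
      fracMap g₄ t₄ hf₄ hs₄ (fracMap g₃ t₃ hf₃ hs₃ x) := by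
  obtain ⟨P, rfl⟩ := Ideal.Quotient.mk_surjective x
  simp only [fracMap_mk]
  congr 1
  ext k
  simp only [Polynomial.comp_C_mul_X_coeff, Polynomial.coeff_map, RingHom.coe_coe, map_mul, map_pow,
    hcomm, mul_assoc, ← mul_pow, ht]

variable [Algebra A C] [IsScalarTower S A C] (I : Ideal A) (f s : A)

variable (S C) in
/-- The map `A[X] / (s X - f) → C[X] / (s X - f)` for an `A`-algebra `C`. -/
def fracBase : FracAlg f s →ₐ[S] FracAlg (algebraMap A C f) (algebraMap A C s) :=
  fracMap (IsScalarTower.toAlgHom S A C) 1 (IsScalarTower.toAlgHom_apply S A C f)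
    ((mul_one _).trans (IsScalarTower.toAlgHom_apply S A C s))

theorem fracBase_map_le : (fracIdeal I f s).map (fracBase S C f s) ≤
    fracIdeal (I.map (algebraMap A C)) (algebraMap A C f) (algebraMap A C s) := by
  rw [fracIdeal, Ideal.map_le_iff_le_comap, Ideal.map_le_iff_le_comap]
  intro a ha
  rw [Ideal.mem_comap, Ideal.mem_comap, fracBase, fracMap_algebraMap]
  exact Ideal.mem_map_of_mem _ (Ideal.mem_map_of_mem _ ha)

theorem fracBase_dense (hC : ∀ n (c : C), ∃ a, c - algebraMap A C a ∈ I.map (algebraMap A C) ^ n)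
    (n : ℕ) (b : FracAlg (algebraMap A C f) (algebraMap A C s)) :
    ∃ a, b - fracBase S C f s a ∈
      fracIdeal (I.map (algebraMap A C)) (algebraMap A C f) (algebraMap A C s) ^ n := by
  obtain ⟨P, rfl⟩ := Ideal.Quotient.mk_surjective b
  induction P using Polynomial.induction_on' with
  | add P Q hP hQ =>
    obtain ⟨a, ha⟩ := hP
    obtain ⟨b, hb⟩ := hQ
    refine ⟨a + b, ?_⟩
    rw [map_add, map_add, add_sub_add_comm]
    exact Ideal.add_mem _ ha hb
  | monomial k c =>
    obtain ⟨a, ha⟩ := hC n c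
    refine ⟨Ideal.Quotient.mk _ (Polynomial.monomial k a), ?_⟩
    have h1 : Ideal.Quotient.mk _ (Polynomial.monomial k c) -
        fracBase S C f s (Ideal.Quotient.mk _ (Polynomial.monomial k a)) =
        algebraMap C (FracAlg (algebraMap A C f) (algebraMap A C s)) (c - algebraMap A C a) *
          Ideal.Quotient.mk _ (Polynomial.X ^ k) := by
      change _ = Ideal.Quotient.mk _ (Polynomial.C _) * _
      rw [fracBase, fracMap_mk, ← map_sub, ← map_mul, Polynomial.C_mul_X_pow_eq_monomial,
        map_sub (Polynomial.monomial k)]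
      congr 2
      rw [Polynomial.C_1, one_mul, Polynomial.comp_X, Polynomial.map_monomial]
      rfl
    rw [h1, fracIdeal, ← Ideal.map_pow]
    exact Ideal.mul_mem_right _ _ (Ideal.mem_map_of_mem _ ha)

/-- The projection `ev` of `C` to `A / I^n` extends, by `X ↦ X`, to a map `π` from the localization
over `C` to the quotient of the localization over `A` by the `n`-th power of its ideal. It kills the
`n`-th power upstairs and restricts to the quotient map. -/
theorem mem_pow_of_fracBase_mem (n : ℕ) (ev : C →ₐ[A] A ⧸ I ^ n) {a : FracAlg f s}
    (ha : fracBase S C f s a ∈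
      fracIdeal (I.map (algebraMap A C)) (algebraMap A C f) (algebraMap A C s) ^ n) :
    a ∈ fracIdeal I f s ^ n := by
  let Q := FracAlg f s ⧸ fracIdeal I f s ^ n
  have hle : I ^ n ≤ (fracIdeal I f s ^ n).comap (algebraMap A (FracAlg f s)) := by
    rw [fracIdeal, ← Ideal.map_pow]
    exact Ideal.le_comap_map
  let ρ : C →+* Q := (Ideal.quotientMap (fracIdeal I f s ^ n) (algebraMap A (FracAlg f s))
    hle).comp (ev : C →+* A ⧸ I ^ n)
  have hρ (x : A) : ρ (algebraMap A C x) =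
      Ideal.Quotient.mk _ (Ideal.Quotient.mk _ (Polynomial.C x)) := by
    change Ideal.quotientMap _ _ hle (ev (algebraMap A C x)) = _
    rw [ev.commutes]
    rfl
  let X' : Q := Ideal.Quotient.mk _ (Ideal.Quotient.mk _ Polynomial.X)
  let π : FracAlg (algebraMap A C f) (algebraMap A C s) →+* Q :=
    Ideal.Quotient.lift _ (Polynomial.eval₂RingHom ρ X') (by
      intro y hy
      rw [Ideal.mem_span_singleton] at hy
      obtain ⟨z, rfl⟩ := hy
      rw [map_mul, map_sub, map_mul, Polynomial.coe_eval₂RingHom, Polynomial.eval₂_C,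
        Polynomial.eval₂_C, Polynomial.eval₂_X, hρ, hρ, ← map_mul, ← map_mul, ← map_sub, ← map_sub,
        Ideal.Quotient.eq_zero_iff_mem.2 (Ideal.mem_span_singleton_self _), map_zero]
      exact zero_mul (M₀ := Q) _)
  have hπ (x : FracAlg f s) : π (fracBase S C f s x) = Ideal.Quotient.mk _ x := by
    obtain ⟨P, rfl⟩ := Ideal.Quotient.mk_surjective x
    rw [fracBase, fracMap_mk]
    change Polynomial.eval₂ ρ X' _ = _
    rw [Polynomial.C_1, one_mul, Polynomial.comp_X, Polynomial.eval₂_map]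
    induction P using Polynomial.induction_on' with
    | add P Q hP hQ => rw [Polynomial.eval₂_add, hP, hQ, map_add, map_add]
    | monomial k c =>
      rw [Polynomial.eval₂_monomial]
      change ρ (algebraMap A C c) * _ = _
      rw [hρ, ← map_pow, ← map_pow, ← map_mul, ← map_mul, Polynomial.C_mul_X_pow_eq_monomial]
  have hker : fracIdeal (I.map (algebraMap A C)) (algebraMap A C f) (algebraMap A C s) ^ n ≤
      RingHom.ker π := by
    rw [fracIdeal, ← Ideal.map_pow, ← Ideal.map_pow, Ideal.map_map, Ideal.map_le_iff_le_comap]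
    intro x hx
    rw [Ideal.mem_comap, RingHom.mem_ker]
    change π (Ideal.Quotient.mk _ (Polynomial.C (algebraMap A C x))) = 0
    change Polynomial.eval₂ ρ X' _ = _
    rw [Polynomial.eval₂_C]
    change Ideal.quotientMap _ _ hle (ev (algebraMap A C x)) = _
    rw [ev.commutes]
    change Ideal.quotientMap _ _ hle (Ideal.Quotient.mk _ x) = _
    rw [Ideal.Quotient.eq_zero_iff_mem.2 hx, map_zero]
  rw [← Ideal.Quotient.eq_zero_iff_mem, ← hπ]
  exact hker ha

end Frac

/-! ## Comparison with the rings `Λ̃_{R₀,[0,b],0}` -/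

section Comparison

variable {p : ℕ} [Fact p.Prime] (R₀ : Type*) [CommRing R₀] [Algebra ℤ_[p] R₀] (u : R₀)
  (w : PowSystem p)

instance : IsScalarTower R₀ (R₀ ⊗[ℤ_[p]] Ainf p) (CTensor R₀ u w) :=
  IsScalarTower.of_algebraMap_eq fun _ ↦ rfl

/-- The projection of `R₀ ⊗̂ A_inf` to `(R₀ ⊗ A_inf) / (u, p, [ϖ]) ^ n`. -/
def cTensorEval (n : ℕ) : CTensor R₀ u w →ₐ[R₀ ⊗[ℤ_[p]] Ainf p]
    (R₀ ⊗[ℤ_[p]] Ainf p) ⧸ tensorIdeal R₀ u w ^ n :=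
  AdicCompletion.evalₐ (tensorIdeal R₀ u w) n

/-- Finite generation of `I` is what makes the kernel of the projection to `A / I^n` equal to the
`n`-th power of the extended ideal. -/
theorem exists_sub_algebraMap_mem_pow {A : Type*} [CommRing A] {I : Ideal A} (hI : I.FG) (n : ℕ)
    (x : AdicCompletion I A) :
    ∃ a, x - algebraMap A _ a ∈ (I.map (algebraMap A (AdicCompletion I A))) ^ n := by
  obtain ⟨a, ha⟩ := Submodule.mkQ_surjective _ (AdicCompletion.eval I A n x)
  refine ⟨a, ?_⟩
  have h : x - algebraMap A _ a ∈ (AdicCompletion.eval I A n).ker := by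
    rw [LinearMap.mem_ker, map_sub, ← ha]
    exact sub_self _
  rw [← AdicCompletion.pow_smul_top_eq_ker_eval hI, Ideal.smul_top_eq_map, Ideal.map_pow] at h
  exact h

theorem cTensor_dense (n : ℕ) (x : CTensor R₀ u w) :
    ∃ a, x - algebraMap (R₀ ⊗[ℤ_[p]] Ainf p) (CTensor R₀ u w) a ∈ cIdeal R₀ u w ^ n :=
  exists_sub_algebraMap_mem_pow (I := tensorIdeal R₀ u w)
    (Submodule.fg_span (by simp)) n x

/-- The map from the completion of `(R₀ ⊗ A_inf)[X] / ([ϖ] ^ (1 / b) X - u)` to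
`Λ̃_{R₀,[0,b],0}`. -/
def toLambda (b : WithTop ℚ≥0) :
    AdicCompletion (fracTIdeal R₀ u w (invExp b)) (FracT R₀ u w (invExp b)) →ₐ[R₀]
      LambdaInt R₀ u w b :=
  adicMap _ _ (fracBase R₀ (CTensor R₀ u w) _ _) (fracBase_map_le (tensorIdeal R₀ u w) _ _)

/-- Completing `R₀ ⊗ A_inf` before localizing changes nothing after the final completion: the
uncompleted localization has dense image and carries the induced topology. -/
theorem toLambda_bijective (b : WithTop ℚ≥0) : Function.Bijective (toLambda R₀ u w b) :=
  adicMap_bijective _ _ (fracBase_dense (tensorIdeal R₀ u w) _ _ (cTensor_dense R₀ u w))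
    fun n _ h ↦ mem_pow_of_fracBase_mem (tensorIdeal R₀ u w) _ _ n (cTensorEval R₀ u w n) h

theorem phiT_map_le {c c' : ℚ≥0} (hc : c' = p * c) :
    (fracTIdeal R₀ u w c).map (phiT R₀ u w hc) ≤ fracTIdeal R₀ u w c' := by
  rw [fracTIdeal, fracIdeal, Ideal.map_le_iff_le_comap, Ideal.map_le_iff_le_comap]
  intro a ha
  rw [Ideal.mem_comap, Ideal.mem_comap, phiT, fracMap_algebraMap]
  exact Ideal.mem_map_of_mem _ (frobT_map_le R₀ u w (Ideal.mem_map_of_mem _ ha))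

theorem inclT_map_le {c c' : ℚ≥0} (hc : c' = p * c) :
    (fracTIdeal R₀ u w c).map (inclT R₀ u w hc) ≤ fracTIdeal R₀ u w c' := by
  rw [fracTIdeal, fracIdeal, Ideal.map_le_iff_le_comap, Ideal.map_le_iff_le_comap]
  intro a ha
  rw [Ideal.mem_comap, Ideal.mem_comap, inclT, fracMap_algebraMap]
  exact Ideal.mem_map_of_mem _ ha

theorem phi_toLambda (b : WithTop ℚ≥0) (x) : phi R₀ u w b (toLambda R₀ u w b x) =
    toLambda R₀ u w (divP p b)
      (adicMap _ _ (phiT R₀ u w (invExp_divP p b)) (phiT_map_le R₀ u w _) x) :=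
  adicMap_comm _ _ _ _ _ _ _ _ (fun a ↦ fracMap_fracMap _ _ _ _ _ _ _ _ _ _ _ _ _ _ _ _
    (fun t ↦ adicMap_of _ _ _ (frobT_map_le R₀ u w) t)
    (by rw [map_one, map_one])
    a) x

theorem incl_toLambda (b : WithTop ℚ≥0) (x) : incl R₀ u w b (toLambda R₀ u w b x) =
    toLambda R₀ u w (divP p b)
      (adicMap _ _ (inclT R₀ u w (invExp_divP p b)) (inclT_map_le R₀ u w _) x) :=
  adicMap_comm _ _ _ _ _ _ _ _ (fun a ↦ fracMap_fracMap _ _ _ _ _ _ _ _ _ _ _ _ _ _ _ _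
    (fun t ↦ by
      rw [AlgHom.id_apply, AlgHom.id_apply])
    (by rw [map_one, one_mul, mul_one, IsScalarTower.toAlgHom_apply])
    a) x

theorem phiSubOne_toLambda (b : WithTop ℚ≥0) (x) : phiSubOne R₀ u w b (toLambda R₀ u w b x) =
    toLambda R₀ u w (divP p b)
      (adicMap _ _ (phiT R₀ u w (invExp_divP p b)) (phiT_map_le R₀ u w _) x -
        adicMap _ _ (inclT R₀ u w (invExp_divP p b)) (inclT_map_le R₀ u w _) x) := by
  rw [map_sub, ← phi_toLambda, ← incl_toLambda]
  rfl

theorem fracTIdeal_map_le (c : ℚ≥0) :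
    (Ideal.span {u}).map (algebraMap R₀ (FracT R₀ u w c)) ≤ fracTIdeal R₀ u w c := by
  rw [Ideal.map_span, Set.image_singleton, Ideal.span_singleton_le_iff_mem, fracTIdeal_eq]
  exact Ideal.subset_span (Set.mem_insert _ _)

theorem exact_of_isAdicComplete [IsAdicComplete (Ideal.span {u}) R₀]
    (hp : ∀ k, ∃ M, (p : R₀) ^ M ∈ Ideal.span {u} ^ k) (b : WithTop ℚ≥0) :
    Function.Injective (algebraMap R₀ (LambdaInt R₀ u w b)) ∧
    Function.Exact (Algebra.linearMap R₀ (LambdaInt R₀ u w b)) (phiSubOne R₀ u w b) ∧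
    Function.Surjective (phiSubOne R₀ u w b) := by
  have hpos : 0 < p := (Fact.out : p.Prime).pos
  have htop (k : ℕ) := exists_forall_mem_pow_of_algebraMap_mem R₀ u w (invExp b) k (hp k)
  have hsurj (n : ℕ) (y) (hy : y ∈ fracTIdeal R₀ u w (invExp (divP p b)) ^ (p * n)) :
      ∃ x ∈ fracTIdeal R₀ u w (invExp b) ^ n, phiT R₀ u w (invExp_divP p b) x -
        inclT R₀ u w (invExp_divP p b) x = y :=
    exists_mem_pow_deltaT_eq R₀ u w (invExp_divP p b) n hy
  refine ⟨?_, fun y ↦ ⟨fun hy ↦ ?_, ?_⟩, fun y ↦ ?_⟩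
  · have h1 : ⇑(algebraMap R₀ (LambdaInt R₀ u w b)) = toLambda R₀ u w b ∘ algebraMap R₀ _ :=
      funext fun r ↦ ((toLambda R₀ u w b).commutes r).symm
    rw [h1]
    exact (toLambda_bijective R₀ u w b).1.comp
      (algebraMap_adicCompletion_injective (Ideal.span {u}) htop)
  · obtain ⟨x, rfl⟩ := (toLambda_bijective R₀ u w b).2 y
    rw [phiSubOne_toLambda, map_eq_zero_iff _ (toLambda_bijective R₀ u w _).1] at hy
    obtain ⟨r, rfl⟩ := exists_algebraMap_eq_of_adicMap_eq _ _ _ _ (Ideal.span {u}) hpos hsurj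
      (fun x hx ↦ exists_algebraMap_eq_of_deltaT_eq_zero R₀ u w (invExp_divP p b) hx) htop
      (fracTIdeal_map_le R₀ u w _) hy
    exact ⟨r, ((toLambda R₀ u w b).commutes r).symm⟩
  · rintro ⟨r, rfl⟩
    change phi R₀ u w b (algebraMap _ _ r) - incl R₀ u w b (algebraMap _ _ r) = 0
    rw [AlgHom.commutes, AlgHom.commutes, sub_self]
  · obtain ⟨y, rfl⟩ := (toLambda_bijective R₀ u w _).2 y
    obtain ⟨x, rfl⟩ := adicMap_sub_surjective _ _ (phiT_map_le R₀ u w _) (inclT_map_le R₀ u w _)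
      hpos hsurj y
    exact ⟨toLambda R₀ u w b x, phiSubOne_toLambda R₀ u w b x⟩

end Comparison

/-! ## Rings of definition of pseudoaffinoid algebras -/

section RingOfDefinition

theorem algebraMap_dvd_algebraMap_ratLoc {A : Type*} [CommRing A] (I : Ideal A) (f s : A) :
    algebraMap A (RatLoc I f s) s ∣ algebraMap A (RatLoc I f s) f := by
  have h1 : algebraMap A (FracAlg f s) s * Ideal.Quotient.mk _ Polynomial.X =
      algebraMap A (FracAlg f s) f :=
    Ideal.Quotient.eq.2 (Ideal.mem_span_singleton_self _)
  have h2 := congrArg (algebraMap (FracAlg f s)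
    (AdicCompletion (fracIdeal I f s) (FracAlg f s))) h1
  rw [map_mul] at h2
  exact ⟨_, h2.symm⟩

variable {p : ℕ} [Fact p.Prime] {lam : ℚ}

theorem exists_natCast_pow_mem_span_uD_pow (hlam : 0 < lam) (k : ℕ) :
    ∃ M, (p : DlamInt p lam) ^ M ∈ Ideal.span {uD p lam} ^ k := by
  refine ⟨lam.den * k, ?_⟩
  rw [pow_mul]
  refine Ideal.pow_mem_pow (Ideal.mem_span_singleton.2 ?_) k
  have h := algebraMap_dvd_algebraMap_ratLoc
    (Ideal.span {(p : PowerSeries ℤ_[p]), PowerSeries.X})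
    ((p : PowerSeries ℤ_[p]) ^ lam.den) (PowerSeries.X ^ lam.num.natAbs)
  rw [map_pow, map_pow, map_natCast] at h
  exact (dvd_pow_self _ (Int.natAbs_pos.2 (Rat.num_pos.2 hlam).ne').ne').trans h

variable {R : Type*} [CommRing R] [UniformSpace R] [IsUniformAddGroup R] [IsTopologicalRing R]
  [CompleteSpace R] [T2Space R] [Algebra (DlamInt p lam) R] {R₀ : Subalgebra (DlamInt p lam) R}

/-- The topology of `R₀` is the quotient of the `u`-adic one on restricted power series, and an open
surjection carries the powers of `(u)` onto the powers of `(u)`. -/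
theorem IsPseudoaffinoidOver.isAdic (h : IsPseudoaffinoidOver R₀) :
    IsAdic (Ideal.span {algebraMap (DlamInt p lam) R₀ (uD p lam)}) := by
  obtain ⟨n, g, hg⟩ := h.finiteType
  let J : Ideal (DlamIntTate p lam n) :=
    Ideal.span {algebraMap (DlamInt p lam) (DlamIntTate p lam n) (uD p lam)}
  let := J.adicTopology
  have hJ := (isAdic_iff (J := J)).1 rfl
  have hmap (k : ℕ) : ((Ideal.span {algebraMap (DlamInt p lam) R₀ (uD p lam)} ^ k : Ideal R₀) :
      Set R₀) = g '' (J ^ k : Ideal _) := by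
    have h1 : Ideal.span {algebraMap (DlamInt p lam) R₀ (uD p lam)} = J.map g := by
      rw [Ideal.map_span, Set.image_singleton, AlgHom.commutes]
    ext x
    rw [h1, ← Ideal.map_pow, SetLike.mem_coe, Ideal.mem_map_iff_of_surjective _ hg.surjective]
    rfl
  have : IsTopologicalRing R₀ := inferInstanceAs (IsTopologicalRing R₀.toSubring)
  rw [isAdic_iff]
  refine ⟨fun k ↦ ?_, fun s hs ↦ ?_⟩
  · rw [hmap]
    exact hg.isOpenMap _ (hJ.1 k)
  · obtain ⟨k, hk⟩ := hJ.2 (g ⁻¹' s) (hg.continuous.continuousAt (by rwa [map_zero]))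
    exact ⟨k, by rw [hmap, Set.image_subset_iff]; exact hk⟩

/-- An open subgroup is closed, so `R₀` inherits completeness and separatedness from `R`. -/
theorem IsPseudoaffinoidOver.isAdicComplete (h : IsPseudoaffinoidOver R₀) :
    IsAdicComplete (Ideal.span {algebraMap (DlamInt p lam) R₀ (uD p lam)}) R₀ := by
  have h1 : IsClosed (R₀ : Set R) :=
    AddSubgroup.isClosed_of_isOpen R₀.toSubring.toAddSubgroup h.isOpen
  have : IsUniformAddGroup R₀ :=
    inferInstanceAs (IsUniformAddGroup R₀.toSubring.toAddSubgroup)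
  exact h.isAdic.isAdicComplete_iff.2 ⟨h1.completeSpace_coe, inferInstance⟩

end RingOfDefinition

end PseudoRigid

end

theorem mainTheorem4 (p : ℕ) [Fact p.Prime] (lam : ℚ) (hlam : 0 < lam)
    {R : Type*} [CommRing R] [UniformSpace R] [IsUniformAddGroup R] [IsTopologicalRing R]
    [CompleteSpace R] [T2Space R]
    [Algebra ℤ_[p] R] [Algebra (PseudoRigid.DlamInt p lam) R] [Algebra (PseudoRigid.Dlam p lam) R]
    [IsScalarTower ℤ_[p] (PseudoRigid.DlamInt p lam) R]
    [IsScalarTower (PseudoRigid.DlamInt p lam) (PseudoRigid.Dlam p lam) R]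
    (R₀ : Subalgebra (PseudoRigid.DlamInt p lam) R)
    (hR₀ : PseudoRigid.IsPseudoaffinoidOver R₀)
    (u : R₀) (hu : u = algebraMap (PseudoRigid.DlamInt p lam) R₀ (PseudoRigid.uD p lam))
    (w : PseudoRigid.PowSystem p) (b : WithTop ℚ≥0) (hb : 0 < b) :
    Function.Injective (algebraMap R₀ (PseudoRigid.LambdaInt R₀ u w b)) ∧
    Function.Exact (Algebra.linearMap R₀ (PseudoRigid.LambdaInt R₀ u w b))
      (PseudoRigid.phiSubOne R₀ u w b) ∧
    Function.Surjective (PseudoRigid.phiSubOne R₀ u w b) := by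
  have hcomplete : IsAdicComplete (Ideal.span {u}) R₀ := hu ▸ hR₀.isAdicComplete
  refine PseudoRigid.exact_of_isAdicComplete R₀ u w (fun k ↦ ?_) b
  -- In `D_λ°` the element `u^(m')` divides `p^m`, and `m' > 0` because `λ > 0`; hence `p` is
  -- topologically nilpotent for the `u`-adic topology.
  obtain ⟨M, hM⟩ := PseudoRigid.exists_natCast_pow_mem_span_uD_pow (p := p) hlam k
  refine ⟨M, ?_⟩
  have h1 := Ideal.mem_map_of_mem (algebraMap (PseudoRigid.DlamInt p lam) R₀) hM
  rwa [Ideal.map_pow, Ideal.map_span, Set.image_singleton, map_pow, map_natCast, ← hu] at h1
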